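/- Let $n\ge 2$ be an integer, $\kappa>0$ and $\lambda>0$. Let $h:(0,\infty)\to[0,\infty)$ be a convex $C^1$ function that is twice differentiable with $$h''(d)>0\ \ \forall\, d>0,\qquad \lim_{d\to0^+}h(d)=\infty,\quad \lim_{d\to\infty}\frac{h(d)}{d}=\infty,\quad \lim_{d\to0^+}h'(d)=-\infty,\quad \lim_{d\to\infty}h'(d)=\infty.$$ Let $$\mathcal A_\lambda=\{\,r\in W^{1,1}(0,1): r(1)=\lambda,\ r'(R)>0 \text{ for a.e. } R\in(0,1),\ r(0)\ge 0\,\},$$ where each $r\in W^{1,1}(0,1)$ is identified with its continuous representative on $[0,1]$ and $r'$ is its weak derivative. For $r\in\mathcal A_\lambda$ put $\delta(R)=r'(R)\left(\frac{r(R)}{R}\right)^{n-1}$ and $$\hat I(r)=\int_0^1 R^{n-1}\left[\frac{\kappa}{n}\,r'(R)^n+h(\delta(R))+\kappa(n-1)\,\delta(R)\left(\frac1n+\ln\frac{r(R)}{R}\right)\right]dR-\frac{\kappa(n-1)}{n}\,\lambda^n\ln\lambda .$$ Here the integral is the integral of the positive part of the integrand minus that of its negative part, and it is assigned the value $-\infty$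 if the integral of the negative part is infinite. Then $\hat I$ has a minimizer over $\mathcal A_\lambda$, and the minimum value is finite: there is $r_0\in\mathcal A_\lambda$ with $\hat I(r_0)\in\mathbb R$ and $\hat I(r_0)\le\hat I(r)$ for all $r\in\mathcal A_\lambda$. (In particular the integral of the negative part is finite for every $r\in\mathcal A_\lambda$, so $\hat I$ is well defined with values in $(-\infty,+\infty]$.) -/

import Mathlib

open MeasureTheory Set Filter Topology
open scoped ContDiff

namespace RadialCavitation

/-- `g` is a weak (distributional) derivative of `r` on the open interval `(0,1)`, both functions
being integrable there: `∫ r φ' = - ∫ g φ` for all smooth `φ` with compact support in `(0,1)`. -/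
def HasWeakDeriv (r g : ℝ → ℝ) : Prop :=
  IntegrableOn r (Ioo 0 1) ∧ IntegrableOn g (Ioo 0 1) ∧
    ∀ φ : ℝ → ℝ, ContDiff ℝ ∞ φ → HasCompactSupport φ → tsupport φ ⊆ Ioo 0 1 →
      ∫ x in Ioo (0 : ℝ) 1, r x * deriv φ x = - ∫ x in Ioo (0 : ℝ) 1, g x * φ x

/-- Membership in the Sobolev space `W^{1,1}(0,1)`. -/
def MemW11 (r : ℝ → ℝ) : Prop := ∃ g : ℝ → ℝ, HasWeakDeriv r g

open Classical in
/-- The weak derivative of `r` on `(0,1)`, which is unique up to null sets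
(junk value `0` if `r` is not in `W^{1,1}(0,1)`). -/
noncomputable def weakDeriv (r : ℝ → ℝ) : ℝ → ℝ :=
  if h : MemW11 r then h.choose else 0

/-- The admissible set `A_λ`. An element of `W^{1,1}(0,1)` is represented by its continuous
representative on `[0,1]`, which gives `r 0` and `r 1` their meaning; values outside `[0,1]`
are irrelevant. -/
def admissible (lam : ℝ) : Set (ℝ → ℝ) :=
  {r | MemW11 r ∧ ContinuousOn r (Icc 0 1) ∧ r 1 = lam ∧
    (∀ᵐ R ∂(volume.restrict (Ioo (0 : ℝ) 1)), 0 < weakDeriv r R) ∧ 0 ≤ r 0}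

/-- The determinant `δ(R) = r'(R) (r(R)/R)^(n-1)`. -/
noncomputable def det (n : ℕ) (r : ℝ → ℝ) (R : ℝ) : ℝ :=
  weakDeriv r R * (r R / R) ^ (n - 1)

/-- The integrand of the modified functional. -/
noncomputable def modifiedIntegrand (n : ℕ) (κ : ℝ) (h r : ℝ → ℝ) (R : ℝ) : ℝ :=
  R ^ (n - 1) * (κ / n * weakDeriv r R ^ n + h (det n r R)
    + κ * ((n : ℝ) - 1) * det n r R * (1 / (n : ℝ) + Real.log (r R / R)))

/-- The modified functional `Î`, with values in the extended reals: the integral is the integral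
of the positive part minus the integral of the negative part of the integrand. Should the
integral of the negative part be infinite, the value is `⊥` by the conventions of `EReal`. -/
noncomputable def modifiedEnergy (n : ℕ) (κ : ℝ) (h : ℝ → ℝ) (lam : ℝ) (r : ℝ → ℝ) : EReal :=
  ((∫⁻ R in Ioo (0 : ℝ) 1, ENNReal.ofReal (modifiedIntegrand n κ h r R) : ENNReal) : EReal)
    - ((∫⁻ R in Ioo (0 : ℝ) 1, ENNReal.ofReal (-modifiedIntegrand n κ h r R) : ENNReal) : EReal)
    - ((κ * ((n : ℝ) - 1) / n * lam ^ n * Real.log lam : ℝ) : EReal)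

/-- The structural conditions on `h : (0,∞) → ℝ`; only the values on `(0,∞)` matter.
Since `deriv` vanishes where the function is not differentiable, `second_deriv_pos` includes
the existence of the second derivative at every `d > 0`. -/
structure StructuralConditions (h : ℝ → ℝ) : Prop where
  contDiffOn : ContDiffOn ℝ 1 h (Ioi 0)
  second_deriv_pos : ∀ d : ℝ, 0 < d → 0 < deriv (deriv h) d
  tendsto_zero : Tendsto h (𝓝[>] 0) atTop
  superlinear : Tendsto (fun d => h d / d) atTop atTop
  deriv_tendsto_zero : Tendsto (deriv h) (𝓝[>] 0) atBot
  deriv_tendsto_top : Tendsto (deriv h) atTop atTop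

end RadialCavitation

/-! The proof replaces the deformation `r` by its determinant `δ`. Put `w = r ^ n` and `L = lam ^
n`. Then `w' = n R^(n-1) δ`, so `w(R) = L - n ∫_R^1 x^(n-1) δ dx` is affine in `δ` (`radiusPow`).
Since `r'^n = δ^n R^(n(n-1)) / w^(n-1)` is a perspective function, it is jointly convex in `(δ, w)`.
Splitting `ln (r/R) = (ln w)/n - ln R` leaves a term linear in `δ` with nonnegative coefficient, and
the term `κ(n-1)/n² (1 + ln w) w'`. The latter is an exact derivative: its boundary value at `1` is
the constant subtracted in the energy, and its boundary value at `0` is a continuous function of the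
one scalar `w(0) ∈ [0, L]`. So the energy is a nonnegative convex functional of `δ` plus a cavity
term (`modifiedEnergy_eq`). Conversely, every positive integrable `δ` with `w(0) ≥ 0` comes from an
admissible `r = w^(1/n)` (`exists_admissible_det_eq`).

The cavity term is not convex, but it is scalar. Along a minimizing sequence, first extract a
subsequence for which `w(0)` converges. Midpoints of members of the sequence are admissible, so
their energy is at least the infimum; since the cavity terms all have the same limit, the convexity
defects of `h` must tend to zero in mean (`integral_midpointGap_le`). Strict convexity and
coercivity of `h` turn this into convergence almost everywhere to a limit in `(0,∞)`
(`exists_subseq_ae_tendsto`), so weak compactness is not needed. Superlinear growth upgrades it to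
convergence in mean (`tendsto_eLpNorm_of_superlinear`). Then `w` converges at every point, the
constraint `w(0) ≥ 0` survives, and Fatou's lemma gives lower semicontinuity
(`exists_minimizer_det`). -/

namespace RadialCavitation

/-! ### Weak derivatives on `(0,1)` and primitives -/

/-- A smooth function with compact support in `(0,1)` is supported in a smaller interval. -/
lemma exists_Icc_support {φ : ℝ → ℝ} (hc : HasCompactSupport φ) (hs : tsupport φ ⊆ Ioo 0 1) :
    ∃ a b : ℝ, 0 < a ∧ a ≤ b ∧ b < 1 ∧ ∀ x, x ∉ Icc a b → φ x = 0 := by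
  by_cases hne : (tsupport φ).Nonempty
  · obtain ⟨a, ha⟩ := hc.isCompact.exists_isLeast hne
    obtain ⟨b, hb⟩ := hc.isCompact.exists_isGreatest hne
    refine ⟨a, b, (hs ha.1).1, ha.2 hb.1, (hs hb.1).2, fun x hx => ?_⟩
    by_contra h0
    have : x ∈ tsupport φ := subset_tsupport _ h0
    exact hx ⟨ha.2 this, hb.2 this⟩
  · refine ⟨1/2, 1/2, by norm_num, le_rfl, by norm_num, fun x _ => ?_⟩
    by_contra h0
    exact hne ⟨x, subset_tsupport _ h0⟩

lemma setIntegral_Ioo_eq_interval (f : ℝ → ℝ) {a b : ℝ} (hab : a ≤ b) :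
    ∫ x in Ioo a b, f x = ∫ x in a..b, f x := by
  rw [intervalIntegral.integral_of_le hab, integral_Ioc_eq_integral_Ioo]

lemma intervalIntegrable_of_Ioo {g : ℝ → ℝ} (hg : IntegrableOn g (Ioo 0 1)) {a b : ℝ}
    (ha : a ∈ Icc (0 : ℝ) 1) (hb : b ∈ Icc (0 : ℝ) 1) : IntervalIntegrable g volume a b := by
  have h01 : IntervalIntegrable g volume 0 1 :=
    (intervalIntegrable_iff_integrableOn_Ioo_of_le zero_le_one).2 hg
  refine h01.mono_set ?_
  rw [uIcc_of_le (zero_le_one' ℝ)]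
  exact uIcc_subset_Icc ha hb

/-- Integration by parts of a primitive against a test function. -/
lemma integral_primitive_mul_deriv {g φ : ℝ → ℝ} (hg : IntegrableOn g (Ioo 0 1)) (c : ℝ)
    (hφ : ContDiff ℝ ∞ φ) (hc : HasCompactSupport φ) (hs : tsupport φ ⊆ Ioo 0 1) :
    ∫ x in Ioo (0 : ℝ) 1, (c + ∫ t in (0 : ℝ)..x, g t) * deriv φ x =
      - ∫ x in Ioo (0 : ℝ) 1, g x * φ x := by
  have hgi : IntervalIntegrable g volume 0 1 :=
    intervalIntegrable_of_Ioo hg (by simp) (by simp)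
  have hW := hgi.absolutelyContinuousOnInterval_intervalIntegral (c := 0) (by simp)
  have hcst : AbsolutelyContinuousOnInterval (fun _ : ℝ => c) 0 1 :=
    (contDiff_const.contDiffOn (𝕜 := ℝ)).absolutelyContinuousOnInterval
  have hF := hcst.add hW
  have hφ1 : ContDiff ℝ 1 φ := hφ.of_le (by exact_mod_cast le_top)
  have hφa : AbsolutelyContinuousOnInterval φ 0 1 := hφ1.contDiffOn.absolutelyContinuousOnInterval
  have key := hF.integral_mul_deriv_eq_deriv_mul hφa
  obtain ⟨a, b, ha, hab, hb, h0⟩ := exists_Icc_support hc hs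
  have e0 : φ 0 = 0 := h0 0 (by simp [ha])
  have e1 : φ 1 = 0 := h0 1 (by simp [hb])
  rw [e0, e1] at key
  simp only [Pi.add_apply, mul_zero, sub_zero, zero_sub] at key
  rw [setIntegral_Ioo_eq_interval _ zero_le_one, setIntegral_Ioo_eq_interval _ zero_le_one, key]
  congr 1
  refine intervalIntegral.integral_congr_ae ?_
  filter_upwards [hgi.ae_hasDerivAt_integral] with x hx hx'
  have := (hx (uIoc_subset_uIcc hx') 0 (by simp)).const_add c
  have e : deriv ((fun _ : ℝ => c) + fun x => ∫ t in (0 : ℝ)..x, g t) x = g x := this.deriv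
  rw [e]

/-- A primitive of an integrable function has that function as a weak derivative. -/
lemma hasWeakDeriv_of_primitive {r g : ℝ → ℝ} (hg : IntegrableOn g (Ioo 0 1))
    (hr : ∀ x ∈ Icc (0 : ℝ) 1, r x = r 0 + ∫ t in (0 : ℝ)..x, g t) : HasWeakDeriv r g := by
  have hgi : IntervalIntegrable g volume 0 1 :=
    intervalIntegrable_of_Ioo hg (by simp) (by simp)
  have hcont : ContinuousOn (fun x => r 0 + ∫ t in (0 : ℝ)..x, g t) (Icc 0 1) := by
    have := (hgi.absolutelyContinuousOnInterval_intervalIntegral (c := 0) (by simp)).continuousOn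
    rw [uIcc_of_le (zero_le_one' ℝ)] at this
    exact continuousOn_const.add this
  refine ⟨?_, hg, fun φ hφ hc hs => ?_⟩
  · have : ContinuousOn r (Icc 0 1) := hcont.congr hr
    exact this.integrableOn_Icc.mono_set Ioo_subset_Icc_self
  · rw [← integral_primitive_mul_deriv hg (r 0) hφ hc hs]
    refine setIntegral_congr_fun measurableSet_Ioo fun x hx => ?_
    rw [hr x (Ioo_subset_Icc_self hx)]

lemma integral_test_eq {f φ : ℝ → ℝ} (hs : tsupport φ ⊆ Ioo 0 1) :
    ∫ x, φ x • f x = ∫ x in Ioo (0 : ℝ) 1, f x * φ x := by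
  rw [← setIntegral_eq_integral_of_forall_compl_eq_zero (s := Ioo (0 : ℝ) 1)]
  · simp [mul_comm]
  · intro x hx
    have : φ x = 0 := by
      by_contra h0
      exact hx (hs (subset_tsupport _ h0))
    simp [this]

lemma integrableOn_mul_test {f φ : ℝ → ℝ} (hf : IntegrableOn f (Ioo 0 1)) (hφ : Continuous φ)
    (hc : HasCompactSupport φ) : IntegrableOn (fun x => f x * φ x) (Ioo 0 1) := by
  obtain ⟨C, hC⟩ := hc.exists_bound_of_continuous hφ
  exact Integrable.mul_bdd (c := C) hf hφ.aestronglyMeasurable (ae_of_all _ hC)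

lemma ae_eq_zero_of_test {f : ℝ → ℝ} (hf : IntegrableOn f (Ioo 0 1))
    (h : ∀ φ : ℝ → ℝ, ContDiff ℝ ∞ φ → HasCompactSupport φ → tsupport φ ⊆ Ioo 0 1 →
      ∫ x in Ioo (0 : ℝ) 1, f x * φ x = 0) :
    ∀ᵐ x ∂(volume.restrict (Ioo (0 : ℝ) 1)), f x = 0 := by
  rw [ae_restrict_iff' measurableSet_Ioo]
  exact isOpen_Ioo.ae_eq_zero_of_integral_contDiff_smul_eq_zero hf.locallyIntegrableOn
    fun φ hφ hc hs => by rw [integral_test_eq hs, h φ hφ hc hs]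

/-- Weak derivatives are unique up to null sets. -/
lemma HasWeakDeriv.ae_unique {r g₁ g₂ : ℝ → ℝ} (h₁ : HasWeakDeriv r g₁) (h₂ : HasWeakDeriv r g₂) :
    g₁ =ᵐ[volume.restrict (Ioo (0 : ℝ) 1)] g₂ := by
  have := ae_eq_zero_of_test (f := fun x => g₁ x - g₂ x) (h₁.2.1.sub h₂.2.1)
    fun φ hφ hc hs => by
      have e := h₁.2.2 φ hφ hc hs
      rw [h₂.2.2 φ hφ hc hs, neg_inj] at e
      simp_rw [sub_mul]
      rw [integral_sub (integrableOn_mul_test h₁.2.1 hφ.continuous hc)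
        (integrableOn_mul_test h₂.2.1 hφ.continuous hc), e, sub_self]
  filter_upwards [this] with x hx
  linarith

lemma MemW11.hasWeakDeriv {r : ℝ → ℝ} (h : MemW11 r) : HasWeakDeriv r (weakDeriv r) := by
  rw [weakDeriv, dif_pos h]
  exact h.choose_spec

lemma HasWeakDeriv.weakDeriv_ae_eq {r g : ℝ → ℝ} (h : HasWeakDeriv r g) :
    weakDeriv r =ᵐ[volume.restrict (Ioo (0 : ℝ) 1)] g :=
  (MemW11.hasWeakDeriv ⟨g, h⟩).ae_unique h

/-- A test function of zero mean is the derivative of a test function. -/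
lemma exists_test_primitive {θ : ℝ → ℝ} (hθ : ContDiff ℝ ∞ θ) (hc : HasCompactSupport θ)
    (hs : tsupport θ ⊆ Ioo 0 1) (h0 : ∫ x in Ioo (0 : ℝ) 1, θ x = 0) :
    ∃ Θ : ℝ → ℝ, ContDiff ℝ ∞ Θ ∧ HasCompactSupport Θ ∧ tsupport Θ ⊆ Ioo 0 1 ∧ deriv Θ = θ := by
  obtain ⟨a, b, ha, hab, hb, hz⟩ := exists_Icc_support hc hs
  have hd : ∀ x, HasDerivAt (fun x => ∫ t in (0 : ℝ)..x, θ t) (θ x) x := fun x =>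
    intervalIntegral.integral_hasDerivAt_right (hθ.continuous.intervalIntegrable _ _)
      hθ.continuous.aestronglyMeasurable.stronglyMeasurableAtFilter hθ.continuous.continuousAt
  have hderiv : deriv (fun x => ∫ t in (0 : ℝ)..x, θ t) = θ := funext fun x => (hd x).deriv
  have hsupp : Function.support (fun x => ∫ t in (0 : ℝ)..x, θ t) ⊆ Icc a b := by
    intro x hx
    by_contra hxn
    apply hx
    rw [mem_Icc, not_and_or, not_le, not_le] at hxn
    rcases hxn with hxa | hxb
    · refine intervalIntegral.integral_zero_ae (ae_of_all _ fun t ht => hz t fun ht' => ?_)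
      rcases ht with ⟨_, ht2⟩
      have := ht'.1
      rcases le_max_iff.1 ht2 with h | h <;> linarith
    -- To the right of `b` the primitive equals the total integral of `θ`, which is zero.
    · have e1 : ∫ t in (b : ℝ)..x, θ t = 0 := by
        refine intervalIntegral.integral_zero_ae (ae_of_all _ fun t ht => hz t fun ht' => ?_)
        rw [uIoc_of_le hxb.le] at ht
        exact absurd ht'.2 (not_le.2 ht.1)
      have e2 : ∫ t in (b : ℝ)..1, θ t = 0 := by
        refine intervalIntegral.integral_zero_ae (ae_of_all _ fun t ht => hz t fun ht' => ?_)
        rw [uIoc_of_le hb.le] at ht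
        exact absurd ht'.2 (not_le.2 ht.1)
      have e3 : ∫ t in (0 : ℝ)..1, θ t = 0 := by
        rw [← setIntegral_Ioo_eq_interval _ zero_le_one, h0]
      have i := fun u v => hθ.continuous.intervalIntegrable (μ := volume) u v
      have j1 := intervalIntegral.integral_add_adjacent_intervals (i 0 b) (i b x)
      have j2 := intervalIntegral.integral_add_adjacent_intervals (i 0 b) (i b 1)
      simp only
      linarith
  have hts : tsupport (fun x => ∫ t in (0 : ℝ)..x, θ t) ⊆ Icc a b :=
    closure_minimal hsupp isClosed_Icc
  refine ⟨_, ?_, ?_, hts.trans fun x hx => ⟨ha.trans_le hx.1, hx.2.trans_lt hb⟩, hderiv⟩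
  · rw [contDiff_infty_iff_deriv]
    exact ⟨fun x => (hd x).differentiableAt, by rw [hderiv]; exact hθ⟩
  · exact isCompact_Icc.of_isClosed_subset (isClosed_tsupport _) hts

/-- Du Bois-Reymond: a continuous function of `W^{1,1}(0,1)` is a primitive of its weak
derivative. -/
lemma HasWeakDeriv.eq_primitive {r g : ℝ → ℝ} (h : HasWeakDeriv r g)
    (hr : ContinuousOn r (Icc 0 1)) :
    ∀ x ∈ Icc (0 : ℝ) 1, r x = r 0 + ∫ t in (0 : ℝ)..x, g t := by
  have hgi : IntervalIntegrable g volume 0 1 :=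
    intervalIntegrable_of_Ioo h.2.1 (by simp) (by simp)
  set W : ℝ → ℝ := fun x => ∫ t in (0 : ℝ)..x, g t with hWdef
  have hWc : ContinuousOn W (Icc 0 1) := by
    have := (hgi.absolutelyContinuousOnInterval_intervalIntegral (c := 0) (by simp)).continuousOn
    rwa [uIcc_of_le (zero_le_one' ℝ)] at this
  have hWi : IntegrableOn W (Ioo 0 1) := hWc.integrableOn_Icc.mono_set Ioo_subset_Icc_self
  have hfi : IntegrableOn (fun x => r x - W x) (Ioo 0 1) := h.1.sub hWi
  obtain ⟨ψ, hψ, hψc, hψs, hψ1⟩ : ∃ ψ : ℝ → ℝ, ContDiff ℝ ∞ ψ ∧ HasCompactSupport ψ ∧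
      tsupport ψ ⊆ Ioo 0 1 ∧ ∫ x in Ioo (0 : ℝ) 1, ψ x = 1 := by
    let b : ContDiffBump (1 / 2 : ℝ) := ⟨1 / 8, 1 / 4, by norm_num, by norm_num⟩
    have hs : tsupport (b.normed volume) ⊆ Ioo 0 1 := by
      rw [b.tsupport_normed_eq, Real.closedBall_eq_Icc]
      intro x hx
      simp only [mem_Icc, b] at hx
      constructor <;> linarith [hx.1, hx.2]
    refine ⟨b.normed volume, b.contDiff_normed, b.hasCompactSupport_normed, hs, ?_⟩
    have := integral_test_eq (f := fun _ => 1) hs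
    simp only [smul_eq_mul, mul_one, one_mul] at this
    rw [← this, b.integral_normed]
  set C := ∫ x in Ioo (0 : ℝ) 1, (r x - W x) * ψ x with hC
  have hzero : ∀ φ : ℝ → ℝ, ContDiff ℝ ∞ φ → HasCompactSupport φ → tsupport φ ⊆ Ioo 0 1 →
      ∫ x in Ioo (0 : ℝ) 1, (r x - W x) * deriv φ x = 0 := by
    intro φ hφ hc hs
    have e1 := h.2.2 φ hφ hc hs
    have e2 := integral_primitive_mul_deriv h.2.1 0 hφ hc hs
    simp only [zero_add] at e2
    simp_rw [sub_mul]
    have hdc : Continuous (deriv φ) := hφ.continuous_deriv (by exact_mod_cast le_top)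
    rw [integral_sub (integrableOn_mul_test h.1 hdc hc.deriv)
      (integrableOn_mul_test hWi hdc hc.deriv), e1, e2, sub_self]
  have hae := ae_eq_zero_of_test (f := fun x => r x - W x - C)
    (hfi.sub (integrableOn_const (by simp))) fun φ hφ hc hs => by
      set c := ∫ x in Ioo (0 : ℝ) 1, φ x
      have hφi : IntegrableOn φ (Ioo 0 1) :=
        (hφ.continuous.integrable_of_hasCompactSupport hc).integrableOn
      have hψi : IntegrableOn ψ (Ioo 0 1) :=
        (hψ.continuous.integrable_of_hasCompactSupport hψc).integrableOn
      -- Subtracting `c * ψ` removes the mean of `φ`, so the difference is the derivative of a test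
      -- function, against which `r - W` integrates to zero.
      obtain ⟨Θ, hΘ, hΘc, hΘs, hΘd⟩ := exists_test_primitive (θ := fun x => φ x - c * ψ x)
        (hφ.sub (contDiff_const.mul hψ)) (hc.sub hψc.mul_left)
        ((tsupport_sub φ (fun x => c * ψ x)).trans
          (union_subset hs ((tsupport_mul_subset_right).trans hψs)))
        (by rw [integral_sub hφi (hψi.const_mul c), integral_const_mul, hψ1, mul_one, sub_self])
      have e := hzero Θ hΘ hΘc hΘs
      rw [hΘd] at e
      have i1 := integrableOn_mul_test hfi hφ.continuous hc
      have i2 := integrableOn_mul_test hfi hψ.continuous hψc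
      have e' : ∫ x in Ioo (0 : ℝ) 1, ((r x - W x) * φ x - c * ((r x - W x) * ψ x)) = 0 := by
        refine Eq.trans (integral_congr_ae (ae_of_all _ fun x => ?_)) e
        ring
      rw [integral_sub i1 (i2.const_mul c), integral_const_mul, ← hC] at e'
      simp_rw [sub_mul _ C]
      rw [integral_sub i1 (hφi.const_mul C), integral_const_mul]
      linarith
  have heq : EqOn (fun x => r x - W x) (fun _ => C) (Icc 0 1) := by
    refine Measure.eqOn_Icc_of_ae_eq (μ := volume) zero_ne_one ?_ (hr.sub hWc) continuousOn_const
    rw [EventuallyEq, ← restrict_Ioo_eq_restrict_Icc]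
    filter_upwards [hae] with x hx
    linarith
  intro x hx
  have h1 := heq hx
  have h2 := heq (left_mem_Icc.2 zero_le_one)
  simp only [hWdef, intervalIntegral.integral_same] at h1 h2
  linarith

/-! ### Chain rule for absolutely continuous functions -/

lemma absolutelyContinuousOnInterval_comp_lipschitzOnWith {Φ F : ℝ → ℝ} {K : NNReal} {s : Set ℝ}
    {a b : ℝ} (hΦ : LipschitzOnWith K Φ s) (hF : AbsolutelyContinuousOnInterval F a b)
    (hs : MapsTo F (uIcc a b) s) : AbsolutelyContinuousOnInterval (fun x => Φ (F x)) a b := by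
  unfold AbsolutelyContinuousOnInterval at hF ⊢
  refine squeeze_zero' (Eventually.of_forall fun _ => Finset.sum_nonneg fun _ _ => dist_nonneg) ?_
    (by simpa using hF.const_mul (K : ℝ))
  rw [eventually_inf_principal]
  filter_upwards with E hE
  rw [Finset.mul_sum]
  refine Finset.sum_le_sum fun i hi => ?_
  exact hΦ.dist_le_mul _ (hs (hE.1 i hi).1) _ (hs (hE.1 i hi).2)

/-- Chain rule and fundamental theorem of calculus for a `C^1` function of a primitive. -/
lemma integral_comp_primitive {r g Φ Φ' : ℝ → ℝ} {a b c d : ℝ} (hab : a ≤ b)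
    (hg : IntervalIntegrable g volume a b)
    (hr : ∀ x ∈ Icc a b, r x = r a + ∫ t in a..x, g t)
    (hmaps : MapsTo r (Icc a b) (Icc c d))
    (hΦ : ∀ y ∈ Icc c d, HasDerivAt Φ (Φ' y) y) (hΦ' : ContinuousOn Φ' (Icc c d)) :
    IntervalIntegrable (fun x => Φ' (r x) * g x) volume a b ∧
      ∫ x in a..b, Φ' (r x) * g x = Φ (r b) - Φ (r a) := by
  set F : ℝ → ℝ := fun x => r a + ∫ t in a..x, g t with hF
  have hcst : AbsolutelyContinuousOnInterval (fun _ : ℝ => r a) a b :=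
    (contDiff_const.contDiffOn (𝕜 := ℝ)).absolutelyContinuousOnInterval
  have hFac : AbsolutelyContinuousOnInterval F a b :=
    hcst.add (hg.absolutelyContinuousOnInterval_intervalIntegral (c := a) (by simp))
  have hFc : ContinuousOn F (Icc a b) := by
    have := hFac.continuousOn
    rwa [uIcc_of_le hab] at this
  have hrc : ContinuousOn r (Icc a b) := hFc.congr hr
  have hFm : MapsTo F (uIcc a b) (Icc c d) := by
    rw [uIcc_of_le hab]
    intro x hx
    have := hmaps hx
    rwa [hr x hx] at this
  obtain ⟨K, hK⟩ := isCompact_Icc.exists_bound_of_continuousOn hΦ'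
  have hLip : LipschitzOnWith K.toNNReal Φ (Icc c d) :=
    (convex_Icc c d).lipschitzOnWith_of_nnnorm_hasDerivWithin_le
      (fun y hy => (hΦ y hy).hasDerivWithinAt) fun y hy => by
        rw [← NNReal.coe_le_coe, coe_nnnorm]
        exact (hK y hy).trans (Real.le_coe_toNNReal K)
  have hac := absolutelyContinuousOnInterval_comp_lipschitzOnWith hLip hFac hFm
  have hint : IntervalIntegrable (fun x => Φ' (r x) * g x) volume a b := by
    refine hg.continuousOn_mul ?_
    rw [uIcc_of_le hab]
    exact hΦ'.comp hrc hmaps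
  refine ⟨hint, ?_⟩
  have e := hac.integral_deriv_eq_sub
  rw [show F b = r b from (hr b (right_mem_Icc.2 hab)).symm,
    show F a = r a from (hr a (left_mem_Icc.2 hab)).symm] at e
  rw [← e]
  refine intervalIntegral.integral_congr_ae ?_
  filter_upwards [hg.ae_hasDerivAt_integral] with x hx hx'
  have hxI := uIoc_subset_uIcc hx'
  have h1 : HasDerivAt F (g x) x := (hx hxI a (by simp)).const_add (r a)
  have h2 := HasDerivAt.comp x (hΦ _ (hFm hxI)) h1
  rw [uIcc_of_le hab] at hxI
  rw [hr x hxI]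
  exact h2.deriv.symm

/-- Version of `integral_comp_primitive` on `(0,1)` for a function which is only `C^1` on `(0,∞)`,
of a positive primitive which may vanish at `0`. -/
lemma integral_comp_primitive_of_nonneg {w p Φ Φ' : ℝ → ℝ}
    (hp : IntegrableOn p (Ioo 0 1))
    (hw : ∀ x ∈ Icc (0 : ℝ) 1, w x = w 0 + ∫ t in (0 : ℝ)..x, p t)
    (hpos : ∀ x ∈ Ioc (0 : ℝ) 1, 0 < w x)
    (hΦ : ∀ y, 0 < y → HasDerivAt Φ (Φ' y) y) (hΦ' : ContinuousOn Φ' (Ioi 0))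
    (hΦw : ContinuousOn (fun x => Φ (w x)) (Icc 0 1))
    (hnn : ∀ᵐ x ∂(volume.restrict (Ioo (0 : ℝ) 1)), 0 ≤ Φ' (w x) * p x) :
    IntegrableOn (fun x => Φ' (w x) * p x) (Ioo 0 1) ∧
      ∀ x ∈ Icc (0 : ℝ) 1, Φ (w x) = Φ (w 0) + ∫ t in (0 : ℝ)..x, Φ' (w t) * p t := by
  have hp01 : IntervalIntegrable p volume 0 1 :=
    intervalIntegrable_of_Ioo hp (by simp) (by simp)
  have hwc : ContinuousOn w (Icc 0 1) := by
    have := (hp01.absolutelyContinuousOnInterval_intervalIntegral (c := 0) (by simp)).continuousOn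
    rw [uIcc_of_le (zero_le_one' ℝ)] at this
    exact (continuousOn_const.add this).congr hw
  -- On `[a, b]` with `a > 0` the function `w` has a positive minimum, so `Φ'` is only evaluated on
  -- a compact subset of `(0,∞)`.
  have key : ∀ a ∈ Ioc (0 : ℝ) 1, ∀ b ∈ Icc a 1,
      IntervalIntegrable (fun x => Φ' (w x) * p x) volume a b ∧
      ∫ x in a..b, Φ' (w x) * p x = Φ (w b) - Φ (w a) := by
    intro a ha b hb
    have hsub : Icc a b ⊆ Icc 0 1 := Icc_subset_Icc ha.1.le hb.2
    have hcw := hwc.mono hsub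
    obtain ⟨x₀, hx₀, hmin⟩ := isCompact_Icc.exists_isMinOn (nonempty_Icc.2 hb.1) hcw
    obtain ⟨x₁, hx₁, hmax⟩ := isCompact_Icc.exists_isMaxOn (nonempty_Icc.2 hb.1) hcw
    have hx₀pos : 0 < w x₀ := hpos x₀ ⟨ha.1.trans_le hx₀.1, hx₀.2.trans hb.2⟩
    refine integral_comp_primitive (c := w x₀) (d := w x₁) hb.1
      (intervalIntegrable_of_Ioo hp ⟨ha.1.le, ha.2⟩ ⟨ha.1.le.trans hb.1, hb.2⟩) ?_
      (fun x hx => ⟨hmin hx, hmax hx⟩) (fun y hy => hΦ y (hx₀pos.trans_le hy.1))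
      (hΦ'.mono fun y hy => hx₀pos.trans_le hy.1)
    intro x hx
    have i1 := intervalIntegrable_of_Ioo hp (a := 0) (b := a) (by simp) ⟨ha.1.le, ha.2⟩
    have i2 := intervalIntegrable_of_Ioo hp (a := a) (b := x) ⟨ha.1.le, ha.2⟩ (hsub hx)
    have := intervalIntegral.integral_add_adjacent_intervals i1 i2
    rw [hw x (hsub hx), hw a ⟨ha.1.le, ha.2⟩, ← this, add_assoc]
  let s : ℕ → ℝ := fun k => 1 / ((k : ℝ) + 1)
  have hs : ∀ k, s k ∈ Ioc (0 : ℝ) 1 := fun k => by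
    refine ⟨by positivity, ?_⟩
    simp only [s]
    rw [div_le_one (by positivity)]
    linarith [Nat.cast_nonneg (α := ℝ) k]
  have hs0 : Tendsto s atTop (𝓝 0) := tendsto_one_div_add_atTop_nhds_zero_nat
  have hs0' : Tendsto s atTop (𝓝[Icc 0 1] 0) :=
    tendsto_nhdsWithin_iff.2 ⟨hs0, Eventually.of_forall fun k => ⟨(hs k).1.le, (hs k).2⟩⟩
  have hΦs : Tendsto (fun k => Φ (w (s k))) atTop (𝓝 (Φ (w 0))) :=
    (hΦw 0 (by simp)).tendsto.comp hs0'
  obtain ⟨C, hC⟩ := isCompact_Icc.exists_bound_of_continuousOn hΦw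
  -- Because the integrand is nonnegative, its `L¹` norm on `(s k, 1)` is an increment of `Φ ∘ w`,
  -- bounded by `2 * C` uniformly in `k`, even if `Φ'` blows up at `0`.
  have hInt : IntegrableOn (fun x => Φ' (w x) * p x) (Ioc 0 1) := by
    refine integrableOn_Ioc_of_intervalIntegral_norm_bounded_left (I := 2 * C) (a := s) (l := atTop)
      (fun k => ?_) hs0 (Eventually.of_forall fun k => ?_)
    · exact (intervalIntegrable_iff_integrableOn_Ioc_of_le (hs k).2).1
        (key (s k) (hs k) 1 ⟨(hs k).2, le_rfl⟩).1
    · have hn : ∀ᵐ x ∂(volume.restrict (Ioc (s k) 1)),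
          ‖Φ' (w x) * p x‖ = Φ' (w x) * p x := by
        rw [← restrict_Ioo_eq_restrict_Ioc]
        have := ae_mono (Measure.restrict_mono (Ioo_subset_Ioo_left (hs k).1.le) le_rfl) hnn
        filter_upwards [this] with x hx
        rw [Real.norm_eq_abs, abs_of_nonneg hx]
      rw [integral_congr_ae hn, ← intervalIntegral.integral_of_le (hs k).2,
        (key (s k) (hs k) 1 ⟨(hs k).2, le_rfl⟩).2]
      have h1 := abs_le.1 (hC 1 (by simp))
      have h2 := abs_le.1 (hC (s k) ⟨(hs k).1.le, (hs k).2⟩)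
      linarith [h1.1, h1.2, h2.1, h2.2]
  have hInt' : IntegrableOn (fun x => Φ' (w x) * p x) (Ioo 0 1) := hInt.mono_set Ioo_subset_Ioc_self
  refine ⟨hInt', fun x hx => ?_⟩
  rcases hx.1.eq_or_lt with rfl | hx0
  · simp
  have hI := intervalIntegrable_of_Ioo hInt' (a := 0) (b := 1) (by simp) (by simp)
  have hprim : ContinuousOn (fun y => ∫ t in (0 : ℝ)..y, Φ' (w t) * p t) (Icc 0 1) := by
    have := (hI.absolutelyContinuousOnInterval_intervalIntegral (c := 0) (by simp)).continuousOn
    rwa [uIcc_of_le (zero_le_one' ℝ)] at this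
  have h1 : Tendsto (fun k => ∫ t in (0 : ℝ)..(s k), Φ' (w t) * p t) atTop (𝓝 0) := by
    have := (hprim 0 (by simp)).tendsto.comp hs0'
    rwa [intervalIntegral.integral_same] at this
  have h2 : Tendsto (fun k => (∫ t in (0 : ℝ)..(s k), Φ' (w t) * p t) + (Φ (w x) - Φ (w (s k))))
      atTop (𝓝 (0 + (Φ (w x) - Φ (w 0)))) := h1.add (hΦs.const_sub _)
  have h3 : (fun k => (∫ t in (0 : ℝ)..(s k), Φ' (w t) * p t) + (Φ (w x) - Φ (w (s k))))
      =ᶠ[atTop] fun _ => ∫ t in (0 : ℝ)..x, Φ' (w t) * p t := by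
    filter_upwards [hs0.eventually (gt_mem_nhds hx0)] with k hk
    rw [← (key (s k) (hs k) x ⟨hk.le, hx.2⟩).2]
    exact intervalIntegral.integral_add_adjacent_intervals
      (intervalIntegrable_of_Ioo hInt' (by simp) ⟨(hs k).1.le, (hs k).2⟩)
      (intervalIntegrable_of_Ioo hInt' ⟨(hs k).1.le, (hs k).2⟩ hx)
  have := tendsto_nhds_unique (h2.congr' h3) tendsto_const_nhds
  linarith

/-- A vanishing integral would force `g = 0` almost everywhere on an interval of positive length.
This yields positivity of both `r` and `w` away from the origin. -/
lemma integral_pos_of_ae_pos {g : ℝ → ℝ} (hg : IntegrableOn g (Ioo 0 1))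
    (hpos : ∀ᵐ x ∂(volume.restrict (Ioo (0 : ℝ) 1)), 0 < g x) {a b : ℝ} (ha : 0 ≤ a) (hab : a < b)
    (hb : b ≤ 1) : 0 < ∫ x in a..b, g x := by
  rw [← setIntegral_Ioo_eq_interval _ hab.le]
  have hsub : Ioo a b ⊆ Ioo 0 1 := Ioo_subset_Ioo ha hb
  have hae : ∀ᵐ x ∂(volume.restrict (Ioo a b)), 0 < g x :=
    ae_mono (Measure.restrict_mono hsub le_rfl) hpos
  have hnn : 0 ≤ᵐ[volume.restrict (Ioo a b)] g := hae.mono fun x hx => hx.le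
  refine lt_of_le_of_ne (integral_nonneg_of_ae hnn) fun h0 => ?_
  have hz := (integral_eq_zero_iff_of_nonneg_ae hnn (hg.mono_set hsub)).1 h0.symm
  have : ∀ᵐ x ∂(volume.restrict (Ioo a b)), False := by
    filter_upwards [hae, hz] with x h1 h2
    simp only [Pi.zero_apply] at h2
    linarith
  rw [ae_iff] at this
  simp at this
  linarith

/-! ### The radial measure and the determinant as the unknown -/

/-- The measure `R^(n-1) dR` on `(0,1)`. -/
noncomputable def radialMeasure (n : ℕ) : Measure ℝ :=
  (volume.restrict (Ioo 0 1)).withDensity fun R => ENNReal.ofReal (R ^ (n - 1))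

lemma measurable_radialWeight (n : ℕ) : Measurable fun R : ℝ => ENNReal.ofReal (R ^ (n - 1)) := by
  fun_prop

/-- The weight `R ^ (n - 1)` is positive on `(0,1)`, so the two measures have the same null sets. -/
lemma ae_radialMeasure_iff {n : ℕ} {P : ℝ → Prop} :
    (∀ᵐ R ∂(radialMeasure n), P R) ↔ ∀ᵐ R ∂(volume.restrict (Ioo (0 : ℝ) 1)), P R := by
  rw [radialMeasure, ae_withDensity_iff (measurable_radialWeight n)]
  refine ⟨fun h => ?_, fun h => h.mono fun x hx _ => hx⟩
  filter_upwards [h, ae_restrict_mem measurableSet_Ioo] with x hx hx'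
  exact hx (by simpa using pow_pos hx'.1 _)

lemma restrict_absolutelyContinuous_radialMeasure (n : ℕ) :
    volume.restrict (Ioo (0 : ℝ) 1) ≪ radialMeasure n := by
  rw [← Measure.ae_le_iff_absolutelyContinuous]
  intro s hs
  exact ae_radialMeasure_iff (P := fun x => x ∈ s).1 hs

lemma radialMeasure_absolutelyContinuous (n : ℕ) :
    radialMeasure n ≪ volume.restrict (Ioo (0 : ℝ) 1) :=
  withDensity_absolutelyContinuous _ _

lemma ae_mem_Ioo_radialMeasure (n : ℕ) : ∀ᵐ R ∂(radialMeasure n), R ∈ Ioo (0 : ℝ) 1 :=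
  ae_radialMeasure_iff.2 (ae_restrict_mem measurableSet_Ioo)

instance isFiniteMeasure_radialMeasure (n : ℕ) : IsFiniteMeasure (radialMeasure n) := by
  refine isFiniteMeasure_withDensity (ne_of_lt ?_)
  calc ∫⁻ R in Ioo (0 : ℝ) 1, ENNReal.ofReal (R ^ (n - 1))
      ≤ ∫⁻ _ in Ioo (0 : ℝ) 1, 1 := by
        refine setLIntegral_mono measurable_const fun R hR => ?_
        rw [ENNReal.ofReal_le_one]
        exact pow_le_one₀ hR.1.le hR.2.le
    _ < ⊤ := by simp

lemma lintegral_radialMeasure (n : ℕ) (f : ℝ → ENNReal) :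
    ∫⁻ R, f R ∂(radialMeasure n) =
      ∫⁻ R in Ioo (0 : ℝ) 1, ENNReal.ofReal (R ^ (n - 1)) * f R := by
  rw [radialMeasure, lintegral_withDensity_eq_lintegral_mul_non_measurable _
    (measurable_radialWeight n) (ae_of_all _ fun _ => ENNReal.ofReal_lt_top)]
  rfl

lemma integrable_radialMeasure_iff {n : ℕ} {f : ℝ → ℝ} :
    Integrable f (radialMeasure n) ↔ IntegrableOn (fun R => R ^ (n - 1) * f R) (Ioo 0 1) := by
  rw [radialMeasure, integrable_withDensity_iff_integrable_smul' (measurable_radialWeight n)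
    (ae_of_all _ fun _ => ENNReal.ofReal_lt_top)]
  refine integrable_congr ?_
  filter_upwards [ae_restrict_mem measurableSet_Ioo] with x hx
  rw [ENNReal.toReal_ofReal (pow_nonneg hx.1.le _), smul_eq_mul]

lemma setIntegral_radialMeasure (n : ℕ) (f : ℝ → ℝ) {a : ℝ} (ha : a ∈ Icc (0 : ℝ) 1) :
    ∫ x in Ioo a 1, f x ∂(radialMeasure n) = ∫ x in a..1, x ^ (n - 1) * f x := by
  rw [radialMeasure, setIntegral_withDensity_eq_setIntegral_toReal_smul
    (measurable_radialWeight n) (ae_of_all _ fun _ => ENNReal.ofReal_lt_top) _ measurableSet_Ioo,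
    Measure.restrict_restrict measurableSet_Ioo,
    inter_eq_left.2 (Ioo_subset_Ioo_left ha.1), ← setIntegral_Ioo_eq_interval _ ha.2]
  refine setIntegral_congr_fun measurableSet_Ioo fun x hx => ?_
  simp only [smul_eq_mul]
  rw [ENNReal.toReal_ofReal (pow_nonneg (ha.1.trans hx.1.le) _)]

lemma setIntegral_Ioo_zero_radialMeasure (n : ℕ) (f : ℝ → ℝ) :
    ∫ x in Ioo 0 1, f x ∂(radialMeasure n) = ∫ x, f x ∂(radialMeasure n) := by
  rw [Measure.restrict_eq_self_of_ae_mem (ae_mem_Ioo_radialMeasure n)]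

/-- The `n`-th power of the deformation with determinant `δ` and boundary value `L^(1/n)`. -/
noncomputable def radiusPow (n : ℕ) (L : ℝ) (δ : ℝ → ℝ) (R : ℝ) : ℝ :=
  L - n * ∫ x in Ioo R 1, δ x ∂(radialMeasure n)

/-- The determinants of admissible deformations. -/
def admissibleDet (n : ℕ) (L : ℝ) : Set (ℝ → ℝ) :=
  {δ | Integrable δ (radialMeasure n) ∧ (∀ᵐ R ∂(radialMeasure n), 0 < δ R) ∧
    n * ∫ R, δ R ∂(radialMeasure n) ≤ L}

section RadiusPow

variable {n : ℕ} {L : ℝ} {δ : ℝ → ℝ}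

lemma radiusPow_one : radiusPow n L δ 1 = L := by simp [radiusPow]

lemma radiusPow_zero : radiusPow n L δ 0 = L - n * ∫ R, δ R ∂(radialMeasure n) := by
  rw [radiusPow, setIntegral_Ioo_zero_radialMeasure]

/-- The integral bound in `admissibleDet` is exactly the constraint `r 0 ≥ 0`, written as `w(0) ≥
0`. -/
lemma radiusPow_zero_nonneg (hδ : δ ∈ admissibleDet n L) : 0 ≤ radiusPow n L δ 0 := by
  rw [radiusPow_zero]
  linarith [hδ.2.2]

lemma radiusPow_zero_le (hδ : δ ∈ admissibleDet n L) : radiusPow n L δ 0 ≤ L := by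
  rw [radiusPow_zero]
  have : 0 ≤ ∫ R, δ R ∂(radialMeasure n) := integral_nonneg_of_ae (hδ.2.1.mono fun x hx => hx.le)
  have := mul_nonneg (Nat.cast_nonneg (α := ℝ) n) this
  linarith

lemma integrableOn_deriv_radiusPow (hδ : Integrable δ (radialMeasure n)) :
    IntegrableOn (fun R => n * (R ^ (n - 1) * δ R)) (Ioo 0 1) :=
  (integrable_radialMeasure_iff.1 hδ).const_mul _

lemma radiusPow_eq_primitive (hδ : Integrable δ (radialMeasure n)) :
    ∀ x ∈ Icc (0 : ℝ) 1, radiusPow n L δ x =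
      radiusPow n L δ 0 + ∫ R in (0 : ℝ)..x, n * (R ^ (n - 1) * δ R) := by
  intro x hx
  have hi := integrable_radialMeasure_iff.1 hδ
  rw [radiusPow, radiusPow, setIntegral_radialMeasure _ _ hx,
    setIntegral_radialMeasure _ _ (by simp), intervalIntegral.integral_const_mul]
  have := intervalIntegral.integral_add_adjacent_intervals
    (intervalIntegrable_of_Ioo hi (a := 0) (b := x) (by simp) hx)
    (intervalIntegrable_of_Ioo hi (a := x) (b := 1) hx (by simp))
  rw [← this]
  ring

lemma ae_deriv_radiusPow_pos (hn : 0 < n) (hδ : ∀ᵐ R ∂(radialMeasure n), 0 < δ R) :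
    ∀ᵐ R ∂(volume.restrict (Ioo (0 : ℝ) 1)), 0 < n * (R ^ (n - 1) * δ R) := by
  filter_upwards [ae_radialMeasure_iff.1 hδ, ae_restrict_mem measurableSet_Ioo] with x hx hx'
  have := pow_pos hx'.1 (n - 1)
  positivity

lemma radiusPow_pos (hn : 0 < n) (hδ : δ ∈ admissibleDet n L) :
    ∀ x ∈ Ioc (0 : ℝ) 1, 0 < radiusPow n L δ x := by
  intro x hx
  rw [radiusPow_eq_primitive hδ.1 x ⟨hx.1.le, hx.2⟩]
  have := integral_pos_of_ae_pos (integrableOn_deriv_radiusPow hδ.1)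
    (ae_deriv_radiusPow_pos hn hδ.2.1) le_rfl hx.1 hx.2
  linarith [radiusPow_zero_nonneg hδ]

lemma radiusPow_le (hδ : δ ∈ admissibleDet n L) :
    ∀ x ∈ Icc (0 : ℝ) 1, radiusPow n L δ x ≤ L := by
  intro x hx
  have : 0 ≤ ∫ R in Ioo x 1, δ R ∂(radialMeasure n) :=
    integral_nonneg_of_ae (ae_restrict_of_ae (hδ.2.1.mono fun x hx => hx.le))
  have := mul_nonneg (Nat.cast_nonneg (α := ℝ) n) this
  rw [radiusPow]
  linarith

lemma continuousOn_radiusPow (hδ : Integrable δ (radialMeasure n)) :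
    ContinuousOn (radiusPow n L δ) (Icc 0 1) := by
  have hi := intervalIntegrable_of_Ioo (integrableOn_deriv_radiusPow hδ) (a := 0) (b := 1)
    (by simp) (by simp)
  have := (hi.absolutelyContinuousOnInterval_intervalIntegral (c := 0) (by simp)).continuousOn
  rw [uIcc_of_le (zero_le_one' ℝ)] at this
  exact (continuousOn_const.add this).congr (radiusPow_eq_primitive hδ)

lemma aemeasurable_radiusPow (hδ : Integrable δ (radialMeasure n)) :
    AEMeasurable (radiusPow n L δ) (radialMeasure n) :=
  (((continuousOn_radiusPow hδ).mono Ioo_subset_Icc_self).aemeasurable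
    measurableSet_Ioo).mono_ac (radialMeasure_absolutelyContinuous n)

end RadiusPow

/-! ### Convex density and cavity term -/

/-- The convex integrand of the energy with respect to `radialMeasure`, in terms of the `n`-th
power `w` of the deformation and of the determinant `d`. -/
noncomputable def convexDensity (n : ℕ) (κ : ℝ) (h : ℝ → ℝ) (R w d : ℝ) : ℝ :=
  κ / n * (d ^ n * R ^ (n * (n - 1)) / w ^ (n - 1)) + h d
    + κ * ((n : ℝ) - 1) * (d * (-Real.log R))

/-- The convex part of the energy, as a function of the determinant. -/
noncomputable def convexEnergy (n : ℕ) (κ : ℝ) (h : ℝ → ℝ) (L : ℝ) (δ : ℝ → ℝ) : ENNReal :=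
  ∫⁻ R, ENNReal.ofReal (convexDensity n κ h R (radiusPow n L δ R) (δ R)) ∂(radialMeasure n)

/-- The contribution to the energy of a cavity with `n`-th power of the radius `c`. -/
noncomputable def cavityEnergy (n : ℕ) (κ c : ℝ) : ℝ :=
  κ * ((n : ℝ) - 1) / n ^ 2 * Real.negMulLog c

lemma continuous_cavityEnergy (n : ℕ) (κ : ℝ) : Continuous (cavityEnergy n κ) :=
  continuous_const.mul Real.continuous_negMulLog

/-- Nothing is known about `h` outside `(0,∞)`, so it is replaced there by zero. -/
lemma aemeasurable_comp_of_ae_pos {α : Type*} [MeasurableSpace α] {μ : Measure α} {h : ℝ → ℝ}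
    {δ : α → ℝ} (hh : ContinuousOn h (Ioi 0)) (hδ : AEMeasurable δ μ)
    (hpos : ∀ᵐ x ∂μ, 0 < δ x) : AEMeasurable (fun x => h (δ x)) μ := by
  have hm : Measurable ((Ioi (0 : ℝ)).piecewise h 0) :=
    hh.measurable_piecewise continuousOn_const measurableSet_Ioi
  refine (hm.comp_aemeasurable hδ).congr ?_
  filter_upwards [hpos] with x hx
  exact piecewise_eq_of_mem _ _ _ (show δ x ∈ Ioi 0 from hx)

lemma aemeasurable_convexDensity {n : ℕ} {κ L : ℝ} {h δ : ℝ → ℝ} (hh : ContinuousOn h (Ioi 0))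
    (hδ : δ ∈ admissibleDet n L) :
    AEMeasurable (fun R => convexDensity n κ h R (radiusPow n L δ R) (δ R)) (radialMeasure n) := by
  have h1 := hδ.1.aestronglyMeasurable.aemeasurable
  have h2 := aemeasurable_radiusPow (L := L) hδ.1
  have h3 := aemeasurable_comp_of_ae_pos hh h1 hδ.2.1
  unfold convexDensity
  exact ((((h1.pow_const n).mul (by fun_prop)).div (h2.pow_const _)).const_mul _ |>.add h3).add
    ((h1.mul (by fun_prop)).const_mul _)

lemma convexDensity_nonneg {n : ℕ} (hn : 1 ≤ n) {κ : ℝ} (hκ : 0 < κ) {h : ℝ → ℝ} {R w d : ℝ}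
    (hh : 0 ≤ h d) (hR : R ∈ Ioo (0 : ℝ) 1) (hw : 0 ≤ w) (hd : 0 ≤ d) :
    0 ≤ convexDensity n κ h R w d := by
  have h1 : 0 ≤ -Real.log R := by
    linarith [Real.log_nonpos hR.1.le hR.2.le]
  have h2 : (0 : ℝ) ≤ (n : ℝ) - 1 := by
    have : (1 : ℝ) ≤ n := by exact_mod_cast hn
    linarith
  have h3 := hR.1.le
  unfold convexDensity
  positivity

/-- Adding an integrable function to a nonnegative one. -/
lemma lintegral_pos_sub_neg {α : Type*} [MeasurableSpace α] {μ : Measure α} {F E : α → ℝ}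
    (hF : AEMeasurable F μ) (hF0 : ∀ᵐ x ∂μ, 0 ≤ F x) (hE : Integrable E μ) :
    ((∫⁻ x, ENNReal.ofReal (F x + E x) ∂μ : ENNReal) : EReal)
      - ((∫⁻ x, ENNReal.ofReal (-(F x + E x)) ∂μ : ENNReal) : EReal)
      = ((∫⁻ x, ENNReal.ofReal (F x) ∂μ : ENNReal) : EReal) + ((∫ x, E x ∂μ : ℝ) : EReal) := by
  have hEf : ∫⁻ x, ENNReal.ofReal (|E x|) ∂μ < ⊤ := by
    have := hE.abs.lintegral_lt_top
    simpa using this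
  have hneg : ∫⁻ x, ENNReal.ofReal (-(F x + E x)) ∂μ < ⊤ := by
    refine lt_of_le_of_lt (lintegral_mono_ae ?_) hEf
    filter_upwards [hF0] with x hx
    exact ENNReal.ofReal_le_ofReal (by linarith [neg_abs_le (E x)])
  by_cases hfin : ∫⁻ x, ENNReal.ofReal (F x) ∂μ = ⊤
  · have htop : ∫⁻ x, ENNReal.ofReal (F x + E x) ∂μ = ⊤ := by
      by_contra hne
      -- Pointwise `F ≤ (F + E)⁺ + |E|`, so an infinite integral of `F` cannot be compensated by the
      -- integrable `E`.
      have hle : ∫⁻ x, ENNReal.ofReal (F x) ∂μ ≤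
          ∫⁻ x, ENNReal.ofReal (F x + E x) ∂μ + ∫⁻ x, ENNReal.ofReal (|E x|) ∂μ := by
        rw [← lintegral_add_right' _ hE.abs.aestronglyMeasurable.aemeasurable.ennreal_ofReal]
        refine lintegral_mono fun x => ?_
        exact (ENNReal.ofReal_le_ofReal (by linarith [neg_abs_le (E x)])).trans
          ENNReal.ofReal_add_le
      rw [hfin, top_le_iff, ENNReal.add_eq_top] at hle
      rcases hle with h | h
      · exact hne h
      · exact hEf.ne h
    rw [hfin, htop]
    lift ∫⁻ x, ENNReal.ofReal (-(F x + E x)) ∂μ to NNReal using hneg.ne with b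
    rw [EReal.coe_ennreal_top, EReal.top_add_coe]
    exact EReal.top_sub_coe (b : ℝ)
  · have hFi : Integrable F μ := by
      refine ⟨hF.aestronglyMeasurable, ?_⟩
      rw [hasFiniteIntegral_iff_ofReal hF0]
      exact lt_top_iff_ne_top.2 hfin
    have hs := integral_eq_lintegral_pos_part_sub_lintegral_neg_part (hFi.add hE)
    have hf := integral_eq_lintegral_of_nonneg_ae hF0 hF.aestronglyMeasurable
    have hadd := integral_add hFi hE
    simp only [Pi.add_apply] at hs
    have hpos : ∫⁻ x, ENNReal.ofReal (F x + E x) ∂μ ≠ ⊤ := (hFi.add hE).lintegral_lt_top.ne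
    rw [← EReal.coe_toReal (x := ((∫⁻ x, ENNReal.ofReal (F x) ∂μ : ENNReal) : EReal))
        (by simpa using hfin) (by simp),
      ← EReal.coe_toReal (x := ((∫⁻ x, ENNReal.ofReal (F x + E x) ∂μ : ENNReal) : EReal))
        (by simpa using hpos) (by simp),
      ← EReal.coe_toReal (x := ((∫⁻ x, ENNReal.ofReal (-(F x + E x)) ∂μ : ENNReal) : EReal))
        (by simpa using hneg.ne) (by simp)]
    simp only [EReal.toReal_coe_ennreal]
    rw [← EReal.coe_sub, ← EReal.coe_add, ← hs, ← hf, hadd]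

/-! ### Correspondence between deformations and determinants -/

section Admissible

variable {n : ℕ} {lam : ℝ} {r : ℝ → ℝ}

lemma admissible_eq_primitive (hr : r ∈ admissible lam) :
    ∀ x ∈ Icc (0 : ℝ) 1, r x = r 0 + ∫ t in (0 : ℝ)..x, weakDeriv r t :=
  hr.1.hasWeakDeriv.eq_primitive hr.2.1

lemma admissible_pos (hr : r ∈ admissible lam) : ∀ x ∈ Ioc (0 : ℝ) 1, 0 < r x := by
  intro x hx
  rw [admissible_eq_primitive hr x ⟨hx.1.le, hx.2⟩]
  have := integral_pos_of_ae_pos hr.1.hasWeakDeriv.2.1 hr.2.2.2.1 le_rfl hx.1 hx.2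
  linarith [hr.2.2.2.2]

lemma radialWeight_mul_det {R : ℝ} (hR : R ≠ 0) :
    (n : ℝ) * (R ^ (n - 1) * det n r R) = n * r R ^ (n - 1) * weakDeriv r R := by
  rw [det, div_pow]
  field_simp

/-- By `radialWeight_mul_det` the integrand is `n r^(n-1) r' = (r^n)'`; this identity makes `r ^ n`
affine in the determinant. -/
lemma admissible_integral_pow (hr : r ∈ admissible lam) {a : ℝ} (ha : a ∈ Icc (0 : ℝ) 1) :
    IntervalIntegrable (fun x => n * (x ^ (n - 1) * det n r x)) volume a 1 ∧
      ∫ x in a..1, n * (x ^ (n - 1) * det n r x) = lam ^ n - r a ^ n := by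
  have hg := hr.1.hasWeakDeriv.2.1
  obtain ⟨M, hM⟩ := isCompact_Icc.exists_bound_of_continuousOn hr.2.1
  have hsub : Icc a 1 ⊆ Icc 0 1 := Icc_subset_Icc_left ha.1
  have key := integral_comp_primitive (r := r) (g := weakDeriv r) (Φ := fun y => y ^ n)
    (Φ' := fun y => n * y ^ (n - 1)) (c := -M) (d := M) ha.2
    (intervalIntegrable_of_Ioo hg ha (by simp)) (fun x hx => by
      have i1 := intervalIntegrable_of_Ioo hg (a := 0) (b := a) (by simp) ha
      have i2 := intervalIntegrable_of_Ioo hg ha (hsub hx)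
      have := intervalIntegral.integral_add_adjacent_intervals i1 i2
      rw [admissible_eq_primitive hr x (hsub hx), admissible_eq_primitive hr a ha, ← this,
        add_assoc])
    (fun x hx => abs_le.1 (hM x (hsub hx))) (fun y _ => hasDerivAt_pow n y) (by fun_prop)
  have hcongr : ∀ x ∈ Ioc a 1, n * r x ^ (n - 1) * weakDeriv r x =
      n * (x ^ (n - 1) * det n r x) := fun x hx =>
    (radialWeight_mul_det (ha.1.trans_lt hx.1).ne').symm
  rw [hr.2.2.1] at key
  refine ⟨?_, ?_⟩
  · refine key.1.congr ?_
    rw [uIoc_of_le ha.2]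
    exact hcongr
  · rw [← key.2]
    refine intervalIntegral.integral_congr_ae (ae_of_all _ fun x hx => ?_)
    rw [uIoc_of_le ha.2] at hx
    exact (hcongr x hx).symm

lemma integrable_det (hn : 0 < n) (hr : r ∈ admissible lam) :
    Integrable (det n r) (radialMeasure n) := by
  rw [integrable_radialMeasure_iff]
  have h1 := (intervalIntegrable_iff_integrableOn_Ioo_of_le zero_le_one).1
    (admissible_integral_pow (n := n) hr (a := 0) (by simp)).1
  have hn' : (n : ℝ) ≠ 0 := by exact_mod_cast hn.ne'
  have h2 := h1.const_mul (n : ℝ)⁻¹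
  refine h2.congr (ae_of_all _ fun x => ?_)
  simp only
  rw [inv_mul_cancel_left₀ hn']

lemma radiusPow_det (hr : r ∈ admissible lam) {x : ℝ} (hx : x ∈ Icc (0 : ℝ) 1) :
    radiusPow n (lam ^ n) (det n r) x = r x ^ n := by
  have := (admissible_integral_pow (n := n) hr hx).2
  rw [intervalIntegral.integral_const_mul] at this
  rw [radiusPow, setIntegral_radialMeasure _ _ hx, this]
  ring

lemma det_mem_admissibleDet (hn : 0 < n) (hr : r ∈ admissible lam) :
    det n r ∈ admissibleDet n (lam ^ n) := by
  refine ⟨integrable_det hn hr, ?_, ?_⟩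
  · rw [ae_radialMeasure_iff]
    filter_upwards [hr.2.2.2.1, ae_restrict_mem measurableSet_Ioo] with x hx hx'
    have := admissible_pos hr x ⟨hx'.1, hx'.2.le⟩
    have := hx'.1
    unfold det
    positivity
  · have h1 := radiusPow_det (n := n) hr (x := 0) (by simp)
    rw [radiusPow_zero] at h1
    have := pow_nonneg hr.2.2.2.2 n
    linarith

/-- The null Lagrangian part of the energy density. -/
lemma integral_nullLagrangian (hn : 0 < n) {L : ℝ} {δ : ℝ → ℝ}
    (hδ : δ ∈ admissibleDet n L) :
    IntegrableOn (fun R => (1 + Real.log (radiusPow n L δ R)) * (n * (R ^ (n - 1) * δ R)))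
        (Ioo 0 1) ∧
      ∫ R in Ioo (0 : ℝ) 1, (1 + Real.log (radiusPow n L δ R)) * (n * (R ^ (n - 1) * δ R)) =
        Real.negMulLog (radiusPow n L δ 0) - Real.negMulLog L := by
  have hp := integrableOn_deriv_radiusPow hδ.1
  have hw := radiusPow_eq_primitive (L := L) hδ.1
  have hpos := radiusPow_pos hn hδ
  -- The linear summant makes `Φ' y = log L - log y`, which is nonnegative because `w ≤ L`. The sign
  -- is what gives integrability up to `R = 0`, where `log w` may be unbounded; the linear part is
  -- subtracted again below.
  have key := integral_comp_primitive_of_nonneg (w := radiusPow n L δ)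
    (Φ := fun y => (1 + Real.log L) * y + Real.negMulLog y)
    (Φ' := fun y => (1 + Real.log L) * 1 + (-Real.log y - 1)) hp hw hpos
    (fun y hy => ((hasDerivAt_id y).const_mul _).add (Real.hasDerivAt_negMulLog hy.ne'))
    (by
      refine continuousOn_const.add (ContinuousOn.sub (ContinuousOn.neg ?_) continuousOn_const)
      exact Real.continuousOn_log.mono fun y hy => (ne_of_gt hy : y ≠ 0))
    (by
      have := continuousOn_radiusPow (L := L) hδ.1
      exact (this.const_mul _).add (Real.continuous_negMulLog.comp_continuousOn this))
    (by
      filter_upwards [ae_deriv_radiusPow_pos hn hδ.2.1, ae_restrict_mem measurableSet_Ioo]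
        with x hx hx'
      refine mul_nonneg ?_ hx.le
      have := Real.log_le_log (hpos x ⟨hx'.1, hx'.2.le⟩)
        (radiusPow_le hδ x (Ioo_subset_Icc_self hx'))
      linarith)
  obtain ⟨hi, he⟩ := key
  have e1 := he 1 (by simp)
  have e2 := hw 1 (by simp)
  rw [radiusPow_one] at e1 e2
  rw [← setIntegral_Ioo_eq_interval _ zero_le_one] at e1 e2
  have hcongr : (fun R => (1 + Real.log (radiusPow n L δ R)) * (n * (R ^ (n - 1) * δ R))) =
      fun R => (1 + Real.log L) * (n * (R ^ (n - 1) * δ R)) -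
        ((1 + Real.log L) * 1 + (-Real.log (radiusPow n L δ R) - 1)) *
          (n * (R ^ (n - 1) * δ R)) := by
    ext R; ring
  rw [hcongr]
  refine ⟨(hp.const_mul _).sub hi, ?_⟩
  rw [integral_sub (hp.const_mul _) hi, integral_const_mul]
  linear_combination (1 + Real.log L) * (-e2) + e1

/-- The energy of a deformation in terms of its determinant. -/
lemma modifiedEnergy_eq (hn : 0 < n) {κ : ℝ} (hκ : 0 < κ) {h : ℝ → ℝ}
    (hh : ContinuousOn h (Ioi 0)) (h_nonneg : ∀ d : ℝ, 0 < d → 0 ≤ h d) (hr : r ∈ admissible lam) :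
    modifiedEnergy n κ h lam r = ((convexEnergy n κ h (lam ^ n) (det n r) : ENNReal) : EReal) +
      ((cavityEnergy n κ (radiusPow n (lam ^ n) (det n r) 0) : ℝ) : EReal) := by
  set L := lam ^ n with hLdef
  have hδ := det_mem_admissibleDet hn hr
  rw [← hLdef] at hδ
  have hn0 : (n : ℝ) ≠ 0 := by exact_mod_cast hn.ne'
  set F : ℝ → ℝ := fun R => R ^ (n - 1) * convexDensity n κ h R (radiusPow n L (det n r) R)
    (det n r R) with hF
  set E : ℝ → ℝ := fun R => κ * ((n : ℝ) - 1) / n ^ 2 *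
    ((1 + Real.log (radiusPow n L (det n r) R)) * (n * (R ^ (n - 1) * det n r R))) with hE
  have hFE : ∀ᵐ R ∂(volume.restrict (Ioo (0 : ℝ) 1)), modifiedIntegrand n κ h r R = F R + E R := by
    filter_upwards [ae_restrict_mem measurableSet_Ioo] with R hR
    have hrpos := admissible_pos hr R ⟨hR.1, hR.2.le⟩
    have hR0 := hR.1
    simp only [hF, hE, modifiedIntegrand, convexDensity]
    rw [radiusPow_det hr (Ioo_subset_Icc_self hR), Real.log_div hrpos.ne' hR0.ne', Real.log_pow]
    have hpw : weakDeriv r R ^ n = det n r R ^ n * R ^ (n * (n - 1)) / (r R ^ n) ^ (n - 1) := by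
      rw [det, mul_pow, ← pow_mul, mul_comm (n - 1) n, div_pow, ← pow_mul]
      field_simp
    rw [hpw]
    field_simp
    ring
  have hFm : AEMeasurable F (volume.restrict (Ioo (0 : ℝ) 1)) :=
    (by fun_prop : Measurable fun R : ℝ => R ^ (n - 1)).aemeasurable.mul
      ((aemeasurable_convexDensity hh hδ).mono_ac (restrict_absolutelyContinuous_radialMeasure n))
  have hF0 : ∀ᵐ R ∂(volume.restrict (Ioo (0 : ℝ) 1)), 0 ≤ F R := by
    filter_upwards [ae_restrict_mem measurableSet_Ioo, ae_radialMeasure_iff.1 hδ.2.1] with R hR hd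
    exact mul_nonneg (pow_nonneg hR.1.le _) (convexDensity_nonneg hn hκ (h_nonneg _ hd) hR
      (radiusPow_pos hn hδ R ⟨hR.1, hR.2.le⟩).le hd.le)
  obtain ⟨hEi, hEint⟩ := integral_nullLagrangian hn hδ
  have hEi' : IntegrableOn E (Ioo 0 1) := hEi.const_mul _
  -- Since `log L = n * log lam`, the boundary term at `R = 1` is the constant subtracted in
  -- `modifiedEnergy`.
  have hEint' : ∫ R in Ioo (0 : ℝ) 1, E R =
      cavityEnergy n κ (radiusPow n L (det n r) 0) + κ * ((n : ℝ) - 1) / n * L * Real.log lam := by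
    simp only [hE]
    rw [integral_const_mul, hEint, cavityEnergy, Real.negMulLog_def]
    simp only
    rw [hLdef, Real.log_pow]
    field_simp
    ring
  have hc1 : ∫⁻ R in Ioo (0 : ℝ) 1, ENNReal.ofReal (modifiedIntegrand n κ h r R) =
      ∫⁻ R in Ioo (0 : ℝ) 1, ENNReal.ofReal (F R + E R) :=
    lintegral_congr_ae (hFE.mono fun R hR => by simp only [hR])
  have hc2 : ∫⁻ R in Ioo (0 : ℝ) 1, ENNReal.ofReal (-modifiedIntegrand n κ h r R) =
      ∫⁻ R in Ioo (0 : ℝ) 1, ENNReal.ofReal (-(F R + E R)) :=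
    lintegral_congr_ae (hFE.mono fun R hR => by simp only [hR])
  have hc3 : convexEnergy n κ h L (det n r) = ∫⁻ R in Ioo (0 : ℝ) 1, ENNReal.ofReal (F R) := by
    rw [convexEnergy, lintegral_radialMeasure]
    refine setLIntegral_congr_fun measurableSet_Ioo fun R hR => ?_
    rw [← ENNReal.ofReal_mul (pow_nonneg hR.1.le _)]
  rw [modifiedEnergy, hc1, hc2, hc3, lintegral_pos_sub_neg hFm hF0 hEi', hEint', ← hLdef,
    sub_eq_add_neg, add_assoc, ← EReal.coe_neg, ← EReal.coe_add]
  congr 2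
  ring

/-- Every admissible determinant is the determinant of an admissible deformation. -/
lemma exists_admissible_det_eq (hn : 0 < n) (hlam : 0 < lam) {δ : ℝ → ℝ}
    (hδ : δ ∈ admissibleDet n (lam ^ n)) :
    ∃ r ∈ admissible lam, det n r =ᵐ[radialMeasure n] δ := by
  set w := radiusPow n (lam ^ n) δ with hwdef
  have hn0 : (n : ℝ) ≠ 0 := by exact_mod_cast hn.ne'
  have hnpos : (0 : ℝ) < n := by exact_mod_cast hn
  have hp := integrableOn_deriv_radiusPow hδ.1
  have hw := radiusPow_eq_primitive (L := lam ^ n) hδ.1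
  have hpos := radiusPow_pos hn hδ
  have hwc := continuousOn_radiusPow (L := lam ^ n) hδ.1
  rw [← hwdef] at hw hpos hwc
  have hrc : Continuous fun y : ℝ => y ^ (1 / n : ℝ) :=
    Real.continuous_rpow_const (by positivity)
  -- If `w 0 = 0` the derivative of `y ^ (1/n)` may blow up along `w`, but `w` increases, so the
  -- derivative of `w ^ (1/n)` is still integrable.
  obtain ⟨hi, he⟩ := integral_comp_primitive_of_nonneg (w := w) (Φ := fun y => y ^ (1 / n : ℝ))
    (Φ' := fun y => (1 / n : ℝ) * y ^ ((1 / n : ℝ) - 1)) hp hw hpos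
    (fun y hy => Real.hasDerivAt_rpow_const (Or.inl hy.ne'))
    (continuousOn_const.mul fun y hy =>
      (Real.continuousAt_rpow_const y _ (Or.inl (ne_of_gt hy))).continuousWithinAt)
    (hrc.comp_continuousOn hwc)
    (by
      filter_upwards [ae_deriv_radiusPow_pos hn hδ.2.1, ae_restrict_mem measurableSet_Ioo]
        with x hx hx'
      have := hpos x ⟨hx'.1, hx'.2.le⟩
      positivity)
  have hwd := hasWeakDeriv_of_primitive (r := fun x => w x ^ (1 / n : ℝ)) hi he
  have hae := hwd.weakDeriv_ae_eq
  have hval : ∀ᵐ R ∂(volume.restrict (Ioo (0 : ℝ) 1)),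
      0 < weakDeriv (fun x => w x ^ (1 / n : ℝ)) R ∧
      det n (fun x => w x ^ (1 / n : ℝ)) R = δ R := by
    filter_upwards [hae, ae_deriv_radiusPow_pos hn hδ.2.1, ae_restrict_mem measurableSet_Ioo]
      with R h1 h2 h3
    have hwR := hpos R ⟨h3.1, h3.2.le⟩
    have hR := h3.1
    constructor
    · rw [h1]
      positivity
    · rw [det, h1, div_pow, ← Real.rpow_natCast (w R ^ (1 / n : ℝ)), ← Real.rpow_mul hwR.le,
        Nat.cast_sub hn, Nat.cast_one]
      have hexp : w R ^ ((1 / n : ℝ) - 1) * w R ^ ((1 / n : ℝ) * ((n : ℝ) - 1)) = 1 := by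
        rw [← Real.rpow_add hwR]
        have : (1 / n : ℝ) - 1 + (1 / n : ℝ) * ((n : ℝ) - 1) = 0 := by field_simp; ring
        rw [this, Real.rpow_zero]
      have hRn : R ^ (n - 1) ≠ 0 := (pow_pos hR _).ne'
      calc _ = (w R ^ ((1 / n : ℝ) - 1) * w R ^ ((1 / n : ℝ) * ((n : ℝ) - 1))) * δ R := by
            field_simp
        _ = δ R := by rw [hexp, one_mul]
  refine ⟨fun x => w x ^ (1 / n : ℝ), ⟨⟨_, hwd⟩, hrc.comp_continuousOn hwc, ?_, ?_, ?_⟩, ?_⟩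
  · simp only [hwdef, radiusPow_one]
    rw [one_div, Real.pow_rpow_inv_natCast hlam.le hn.ne']
  · exact hval.mono fun x hx => hx.1
  · exact Real.rpow_nonneg (radiusPow_zero_nonneg hδ) _
  · exact ae_radialMeasure_iff.2 (hval.mono fun x hx => hx.2)

lemma radiusPow_congr {L : ℝ} {δ₁ δ₂ : ℝ → ℝ} (h : δ₁ =ᵐ[radialMeasure n] δ₂) (R : ℝ) :
    radiusPow n L δ₁ R = radiusPow n L δ₂ R := by
  rw [radiusPow, radiusPow, integral_congr_ae (ae_restrict_of_ae h)]

lemma convexEnergy_congr {L κ : ℝ} {h δ₁ δ₂ : ℝ → ℝ} (hδ : δ₁ =ᵐ[radialMeasure n] δ₂) :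
    convexEnergy n κ h L δ₁ = convexEnergy n κ h L δ₂ := by
  refine lintegral_congr_ae ?_
  filter_upwards [hδ] with R hR
  rw [radiusPow_congr hδ, hR]

end Admissible

/-! ### Quantitative strict convexity -/

/-- The defect of midpoint convexity. -/
noncomputable def midpointGap (h : ℝ → ℝ) (x y : ℝ) : ℝ := (h x + h y) / 2 - h ((x + y) / 2)

lemma midpointGap_nonneg {h : ℝ → ℝ} (hc : ConvexOn ℝ (Ioi 0) h) {x y : ℝ} (hx : 0 < x)
    (hy : 0 < y) : 0 ≤ midpointGap h x y := by
  have key := hc.2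
  have := key (mem_Ioi.2 hx) (mem_Ioi.2 hy)
    (a := 1 / 2) (b := 1 / 2) (by norm_num) (by norm_num) (by norm_num)
  simp only [smul_eq_mul] at this
  rw [show 1 / 2 * x + 1 / 2 * y = (x + y) / 2 by ring] at this
  unfold midpointGap
  linarith

lemma midpointGap_pos {h : ℝ → ℝ} (hc : StrictConvexOn ℝ (Ioi 0) h) {x y : ℝ} (hx : 0 < x)
    (hy : 0 < y) (hxy : x ≠ y) : 0 < midpointGap h x y := by
  have key := hc.2
  have := key (mem_Ioi.2 hx) (mem_Ioi.2 hy) hxy (a := 1 / 2) (b := 1 / 2) (by norm_num)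
    (by norm_num) (by norm_num)
  simp only [smul_eq_mul] at this
  rw [show 1 / 2 * x + 1 / 2 * y = (x + y) / 2 by ring] at this
  unfold midpointGap
  linarith

lemma abs_exp_neg_sub_le_one {x y : ℝ} (hx : 0 < x) (hy : 0 < y) :
    |Real.exp (-x) - Real.exp (-y)| ≤ 1 := by
  have h1 : Real.exp (-x) ≤ 1 := Real.exp_le_one_iff.2 (by linarith)
  have h2 : Real.exp (-y) ≤ 1 := Real.exp_le_one_iff.2 (by linarith)
  rw [abs_le]
  constructor <;> linarith [Real.exp_pos (-x), Real.exp_pos (-y)]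

/-- A coercive strictly convex function on `(0,∞)` controls distances by its midpoint gap. -/
lemma exists_abs_exp_neg_sub_le {h : ℝ → ℝ} (hc : StrictConvexOn ℝ (Ioi 0) h)
    (hcont : ContinuousOn h (Ioi 0)) (hnn : ∀ d, 0 < d → 0 ≤ h d)
    (h0 : Tendsto h (𝓝[>] 0) atTop) (htop : Tendsto h atTop atTop) {ε : ℝ} (hε : 0 < ε) :
    ∃ C, 0 ≤ C ∧ ∀ x y, 0 < x → 0 < y →
      |Real.exp (-x) - Real.exp (-y)| ≤ ε + ε * (h x + h y) + C * midpointGap h x y := by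
  -- Outside `[a, b]` coercivity gives `ε * h ≥ 1`, which already dominates the difference of
  -- exponentials.
  obtain ⟨a, ha0, ha⟩ : ∃ a > 0, ∀ x, 0 < x → x < a → 1 / ε ≤ h x := by
    have := h0.eventually_ge_atTop (1 / ε)
    obtain ⟨a, ha, hsub⟩ := mem_nhdsGT_iff_exists_Ioo_subset.1 this
    exact ⟨a, ha, fun x hx hxa => hsub ⟨hx, hxa⟩⟩
  obtain ⟨b, hb⟩ := eventually_atTop.1 (htop.eventually_ge_atTop (1 / ε))
  -- On this compact set, which avoids the diagonal, the gap has a positive minimum; `C` is its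
  -- reciprocal, or `0` if the set is empty.
  set S : Set (ℝ × ℝ) := (Icc a b ×ˢ Icc a b) ∩
    {z | ε ≤ |Real.exp (-z.1) - Real.exp (-z.2)|} with hS
  have hScomp : IsCompact S := (isCompact_Icc.prod isCompact_Icc).inter_right
    (isClosed_le continuous_const (by fun_prop))
  have hgc : ContinuousOn (fun z : ℝ × ℝ => midpointGap h z.1 z.2) S := by
    have hpos : ∀ z ∈ S, 0 < z.1 ∧ 0 < z.2 := fun z hz =>
      ⟨ha0.trans_le hz.1.1.1, ha0.trans_le hz.1.2.1⟩
    unfold midpointGap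
    refine ContinuousOn.sub (ContinuousOn.div_const (ContinuousOn.add ?_ ?_) 2) ?_
    · exact hcont.comp (by fun_prop) fun z hz => (hpos z hz).1
    · exact hcont.comp (by fun_prop) fun z hz => (hpos z hz).2
    · refine hcont.comp (by fun_prop) fun z hz => ?_
      have := hpos z hz
      show 0 < (z.1 + z.2) / 2
      linarith [this.1, this.2]
  obtain ⟨C, hC0, hC⟩ : ∃ C, 0 ≤ C ∧ ∀ z ∈ S, 1 ≤ C * midpointGap h z.1 z.2 := by
    by_cases hne : S.Nonempty
    · obtain ⟨z₀, hz₀, hmin⟩ := hScomp.exists_isMinOn hne hgc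
      have hneq : z₀.1 ≠ z₀.2 := fun heq => by
        have := hz₀.2
        simp only [heq, sub_self, abs_zero, mem_ofPred_eq] at this
        linarith
      have hp := midpointGap_pos hc (ha0.trans_le hz₀.1.1.1) (ha0.trans_le hz₀.1.2.1) hneq
      refine ⟨1 / midpointGap h z₀.1 z₀.2, by positivity, fun z hz => ?_⟩
      rw [one_div_mul_eq_div, one_le_div hp]
      exact hmin hz
    · exact ⟨0, le_rfl, fun z hz => (hne ⟨z, hz⟩).elim⟩
  refine ⟨C, hC0, fun x y hx hy => ?_⟩
  have hg := mul_nonneg hC0 (midpointGap_nonneg hc.convexOn hx hy)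
  have h1 := abs_exp_neg_sub_le_one hx hy
  have hhx := mul_nonneg hε.le (hnn x hx)
  have hhy := mul_nonneg hε.le (hnn y hy)
  have big : ∀ u, 1 / ε ≤ h u → 1 ≤ ε * h u := fun u hu => by
    rwa [div_le_iff₀' hε] at hu
  by_cases hxI : x ∈ Icc a b
  · by_cases hyI : y ∈ Icc a b
    · by_cases hd : ε ≤ |Real.exp (-x) - Real.exp (-y)|
      · have := hC (x, y) ⟨⟨hxI, hyI⟩, hd⟩
        simp only at this
        linarith
      · linarith
    · have : 1 / ε ≤ h y := by
        rw [mem_Icc, not_and_or, not_le, not_le] at hyI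
        exact hyI.elim (ha y hy) fun hh => hb y hh.le
      linarith [big y this]
  · have : 1 / ε ≤ h x := by
      rw [mem_Icc, not_and_or, not_le, not_le] at hxI
      exact hxI.elim (ha x hx) fun hh => hb x hh.le
    linarith [big x this]

/-! ### Compactness from vanishing midpoint gaps -/

section Compactness

variable {α : Type*} [MeasurableSpace α] {μ : Measure α} {h : ℝ → ℝ}
  {d : ℕ → α → ℝ} {C₀ : ℝ}

/-- By Fatou's lemma the lower limit of `h (d k x)` is finite almost everywhere. This later prevents
`d k x` from tending to `0` or to infinity. -/
lemma exists_frequently_le_of_integral_le (hnn : ∀ x, 0 < x → 0 ≤ h x)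
    (hpos : ∀ k, ∀ᵐ x ∂μ, 0 < d k x) (hint : ∀ k, Integrable (fun x => h (d k x)) μ)
    (hbd : ∀ k, ∫ x, h (d k x) ∂μ ≤ C₀) :
    ∀ᵐ x ∂μ, ∃ M : ℝ, ∃ᶠ k in atTop, h (d k x) < M := by
  have hm : ∀ k, AEMeasurable (fun x => ENNReal.ofReal (h (d k x))) μ := fun k =>
    (hint k).aestronglyMeasurable.aemeasurable.ennreal_ofReal
  have hle : ∫⁻ x, liminf (fun k => ENNReal.ofReal (h (d k x))) atTop ∂μ ≤ ENNReal.ofReal C₀ := by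
    refine (lintegral_liminf_le' hm).trans ?_
    refine liminf_le_of_frequently_le' (Frequently.of_forall fun k => ?_)
    rw [← ofReal_integral_eq_lintegral_ofReal (hint k)
      ((hpos k).mono fun x hx => hnn _ hx)]
    exact ENNReal.ofReal_le_ofReal (hbd k)
  have hmk : ∀ᵐ x ∂μ, ∀ k, ENNReal.ofReal (h (d k x)) = (hm k).mk _ x :=
    ae_all_iff.2 fun k => (hm k).ae_eq_mk
  have hlm : AEMeasurable (fun x => liminf (fun k => ENNReal.ofReal (h (d k x))) atTop) μ := by
    refine ⟨fun x => liminf (fun k => (hm k).mk _ x) atTop,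
      Measurable.liminf fun k => (hm k).measurable_mk, ?_⟩
    filter_upwards [hmk] with x hx
    simp only [hx]
  have hlt := ae_lt_top' hlm (hle.trans_lt ENNReal.ofReal_lt_top).ne
  filter_upwards [hlt] with x hx
  obtain ⟨M, hM1, hM2⟩ := ENNReal.lt_iff_exists_nnreal_btwn.1 hx
  refine ⟨M, (frequently_lt_of_liminf_lt (by isBoundedDefault) hM1).mono fun k hk => ?_⟩
  rw [← ENNReal.ofReal_coe_nnreal] at hk
  exact (ENNReal.ofReal_lt_ofReal_iff'.1 hk).1

variable [IsFiniteMeasure μ]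

/-- If the midpoint gaps of a coercive strictly convex function tend to zero in mean along a
sequence of bounded energy, then a subsequence converges almost everywhere. -/
lemma exists_subseq_ae_tendsto (hc : StrictConvexOn ℝ (Ioi 0) h)
    (hcont : ContinuousOn h (Ioi 0)) (hnn : ∀ x, 0 < x → 0 ≤ h x)
    (h0 : Tendsto h (𝓝[>] 0) atTop) (htop : Tendsto h atTop atTop)
    (hm : ∀ k, AEMeasurable (d k) μ)
    (hpos : ∀ k, ∀ᵐ x ∂μ, 0 < d k x) (hint : ∀ k, Integrable (fun x => h (d k x)) μ)
    (hbd : ∀ k, ∫ x, h (d k x) ∂μ ≤ C₀)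
    (hgi : ∀ k l, Integrable (fun x => midpointGap h (d k x) (d l x)) μ)
    (hgap : ∀ ε > 0, ∃ N, ∀ k ≥ N, ∀ l ≥ N, ∫ x, midpointGap h (d k x) (d l x) ∂μ ≤ ε) :
    ∃ σ : ℕ → ℕ, StrictMono σ ∧ ∃ δ : α → ℝ, ∀ᵐ x ∂μ, 0 < δ x ∧
      Tendsto (fun k => d (σ k) x) atTop (𝓝 (δ x)) := by
  -- `exp (-·)` maps `(0,∞)` injectively into a bounded interval, so escape to infinity becomes
  -- convergence to `0`.
  set f : ℕ → α → ℝ := fun k x => Real.exp (-d k x) with hf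
  have hfm : ∀ k, AEStronglyMeasurable (f k) μ := fun k =>
    (Real.measurable_exp.comp_aemeasurable (hm k).neg).aestronglyMeasurable
  have hfi : ∀ k l, Integrable (f k - f l) μ := fun k l => by
    refine Integrable.of_bound ((hfm k).sub (hfm l)) 1 ?_
    filter_upwards [hpos k, hpos l] with x h1 h2
    exact abs_exp_neg_sub_le_one h1 h2
  have hC₀ : 0 ≤ C₀ :=
    (integral_nonneg_of_ae ((hpos 0).mono fun x hx => hnn _ hx)).trans (hbd 0)
  have hcau : ∀ η : ℝ, 0 < η → ∃ N, ∀ k ≥ N, ∀ l ≥ N, ∫ x, ‖(f k - f l) x‖ ∂μ < η := by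
    intro η hη
    -- With `ε = η / (2 * A)` the first two terms of the estimate contribute at most `η / 2` and the
    -- gap term at most `η / 4`; the added `1` keeps `A` positive.
    set A := μ.real univ + 2 * C₀ + 1 with hA
    have hApos : 0 < A := by have := measureReal_nonneg (μ := μ) (s := univ); positivity
    obtain ⟨C, hC0, hC⟩ := exists_abs_exp_neg_sub_le hc hcont hnn h0 htop
      (ε := η / (2 * A)) (by positivity)
    obtain ⟨N, hN⟩ := hgap (η / (4 * (C + 1))) (by positivity)
    refine ⟨N, fun k hk l hl => ?_⟩
    have hle : ∫ x, ‖(f k - f l) x‖ ∂μ ≤ ∫ x, (η / (2 * A) + η / (2 * A) *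
        (h (d k x) + h (d l x)) + C * midpointGap h (d k x) (d l x)) ∂μ := by
      refine integral_mono_ae (hfi k l).norm (((integrable_const _).add
        (((hint k).add (hint l)).const_mul _)).add ((hgi k l).const_mul _)) ?_
      filter_upwards [hpos k, hpos l] with x h1 h2
      exact hC _ _ h1 h2
    refine hle.trans_lt ?_
    have hkl : Integrable (fun x => η / (2 * A) * (h (d k x) + h (d l x))) μ :=
      ((hint k).add (hint l)).const_mul _
    have hsum : Integrable (fun x => η / (2 * A) + η / (2 * A) * (h (d k x) + h (d l x))) μ :=
      (integrable_const _).add hkl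
    rw [integral_add hsum ((hgi k l).const_mul _), integral_add (integrable_const _) hkl,
      integral_const_mul, integral_const_mul, integral_add (hint k) (hint l), integral_const,
      smul_eq_mul]
    have e1 : C * ∫ x, midpointGap h (d k x) (d l x) ∂μ ≤ η / 4 := by
      calc _ ≤ C * (η / (4 * (C + 1))) := mul_le_mul_of_nonneg_left (hN k hk l hl) hC0
        _ = η / 4 * (C / (C + 1)) := by field_simp
        _ ≤ η / 4 * 1 := by
            refine mul_le_mul_of_nonneg_left ?_ (by positivity)
            rw [div_le_one (by positivity)]; linarith
        _ = η / 4 := mul_one _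
    have e2 : μ.real univ * (η / (2 * A)) + η / (2 * A) *
        (∫ x, h (d k x) ∂μ + ∫ x, h (d l x) ∂μ) ≤ η / (2 * A) * A := by
      have : 0 < η / (2 * A) := by positivity
      rw [mul_comm (μ.real univ), ← mul_add]
      refine mul_le_mul_of_nonneg_left ?_ this.le
      linarith [hbd k, hbd l]
    have e3 : η / (2 * A) * A = η / 2 := by field_simp
    linarith
  -- Summable Cauchy bounds along a subsequence give convergence almost everywhere.
  have hcau' : ∀ N : ℕ, ∃ K, ∀ k ≥ K, ∀ l ≥ k, ∀ m ≥ k,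
      eLpNorm (f l - f m) 1 μ < (2⁻¹ : ENNReal) ^ N := by
    intro N
    obtain ⟨K, hK⟩ := hcau ((2⁻¹ : ℝ) ^ N) (by positivity)
    refine ⟨K, fun k hk l hl m hm => ?_⟩
    rw [eLpNorm_one_eq_lintegral_enorm, ← ofReal_integral_norm_eq_lintegral_enorm (hfi l m),
      show (2⁻¹ : ENNReal) ^ N = ENNReal.ofReal ((2⁻¹ : ℝ) ^ N) by
        rw [ENNReal.ofReal_pow (by positivity), ENNReal.ofReal_inv_of_pos (by positivity)]
        simp]
    exact (ENNReal.ofReal_lt_ofReal_iff (by positivity)).2 (hK l (hk.trans hl) m (hk.trans hm))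
  obtain ⟨σ, hσ, hσc⟩ := extraction_forall_of_eventually' hcau'
  have hlim := Lp.ae_tendsto_of_cauchy_eLpNorm (μ := μ) (p := 1) (f := fun k => f (σ k))
    (fun k => hfm (σ k)) le_rfl (B := fun N => (2⁻¹ : ENNReal) ^ N)
    (by rw [ENNReal.tsum_geometric, ENNReal.one_sub_inv_two, inv_inv]; exact ENNReal.ofNat_ne_top)
    (fun N k l hk hl => hσc N _ (hσ.monotone hk) _ (hσ.monotone hl))
  have hfreq := exists_frequently_le_of_integral_le (μ := μ) (d := fun k => d (σ k)) hnn
    (fun k => hpos (σ k)) (fun k => hint (σ k)) (fun k => hbd (σ k))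
  have hposall : ∀ᵐ x ∂μ, ∀ k, 0 < d k x := ae_all_iff.2 hpos
  refine ⟨σ, hσ, fun x => -Real.log (limUnder atTop fun k => f (σ k) x), ?_⟩
  filter_upwards [hlim, hfreq, hposall] with x ⟨q, hq⟩ ⟨M, hM⟩ hp
  rw [hq.limUnder_eq]
  have hd : ∀ k, d (σ k) x = -Real.log (f (σ k) x) := fun k => by simp [hf]
  have hq0 : 0 ≤ q := ge_of_tendsto' hq fun k => (Real.exp_pos _).le
  have hq1 : q ≤ 1 := le_of_tendsto' hq fun k =>
    Real.exp_le_one_iff.2 (by linarith [hp (σ k)])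
  have hnot : ¬ Tendsto (fun k => h (d (σ k) x)) atTop atTop := fun ht => by
    obtain ⟨k, hk1, hk2⟩ := (hM.and_eventually (ht.eventually_ge_atTop M)).exists
    linarith
  -- `q = 0` would mean `d → ∞`, and `q = 1` below would mean `d → 0`; in both cases `h` would tend
  -- to infinity.
  have hq0' : q ≠ 0 := fun hz => hnot <| by
    rw [hz] at hq
    refine htop.comp ?_
    simp_rw [hd]
    exact tendsto_neg_atBot_atTop.comp (Real.tendsto_log_nhdsGT_zero.comp
      (tendsto_nhdsWithin_iff.2 ⟨hq, Eventually.of_forall fun k => Real.exp_pos _⟩))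
  have hlimd : Tendsto (fun k => d (σ k) x) atTop (𝓝 (-Real.log q)) := by
    simp_rw [hd]
    exact ((Real.continuousAt_log hq0').tendsto.comp hq).neg
  have hq1' : q ≠ 1 := fun hz => hnot <| by
    rw [hz, Real.log_one, neg_zero] at hlimd
    exact h0.comp (tendsto_nhdsWithin_iff.2 ⟨hlimd, Eventually.of_forall fun k => hp (σ k)⟩)
  refine ⟨?_, hlimd⟩
  linarith [Real.log_neg (lt_of_le_of_ne hq0 hq0'.symm) (lt_of_le_of_ne hq1 hq1')]

/-- De la Vallée-Poussin and Vitali: almost everywhere convergence with bounded superlinear energy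
implies convergence in mean. -/
lemma tendsto_eLpNorm_of_superlinear (hnn : ∀ x, 0 < x → 0 ≤ h x)
    (hsup : Tendsto (fun x => h x / x) atTop atTop)
    (hm : ∀ k, AEStronglyMeasurable (d k) μ) (hpos : ∀ k, ∀ᵐ x ∂μ, 0 < d k x)
    (hint : ∀ k, Integrable (fun x => h (d k x)) μ) (hbd : ∀ k, ∫ x, h (d k x) ∂μ ≤ C₀)
    {δ : α → ℝ} (hlim : ∀ᵐ x ∂μ, Tendsto (fun k => d k x) atTop (𝓝 (δ x))) :
    Integrable δ μ ∧ Tendsto (fun k => eLpNorm (d k - δ) 1 μ) atTop (𝓝 0) := by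
  have hC₀ : 0 ≤ C₀ :=
    (integral_nonneg_of_ae ((hpos 0).mono fun x hx => hnn _ hx)).trans (hbd 0)
  have hUI : UniformIntegrable d 1 μ := by
    refine uniformIntegrable_of le_rfl ENNReal.one_ne_top hm fun ε hε => ?_
    -- Beyond `M` one has `d ≤ ε / (C₀ + 1) * h d`, so the tails have integral at most `ε`,
    -- uniformly in `k`.
    have hev := hsup.eventually_ge_atTop ((C₀ + 1) / ε)
    obtain ⟨M, hM⟩ := eventually_atTop.1 hev
    refine ⟨Real.toNNReal M, fun k => ?_⟩
    rw [eLpNorm_one_eq_lintegral_enorm]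
    have hle : ∫⁻ x, ‖({x | M.toNNReal ≤ ‖d k x‖₊}.indicator (d k)) x‖ₑ ∂μ ≤
        ∫⁻ x, ENNReal.ofReal (ε / (C₀ + 1) * h (d k x)) ∂μ := by
      refine lintegral_mono_ae ?_
      filter_upwards [hpos k] with x hx
      have hh := hnn _ hx
      by_cases hmem : x ∈ {x | M.toNNReal ≤ ‖d k x‖₊}
      · rw [indicator_of_mem hmem, ← ofReal_norm, Real.norm_eq_abs, abs_of_pos hx]
        have hMd : M ≤ d k x := by
          have h1 : (M.toNNReal : ℝ) ≤ ‖d k x‖ := by exact_mod_cast hmem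
          rw [Real.norm_eq_abs, abs_of_pos hx] at h1
          exact (Real.le_coe_toNNReal M).trans h1
        have h2 := hM _ hMd
        refine ENNReal.ofReal_le_ofReal ?_
        rw [le_div_iff₀ hx, div_mul_eq_mul_div, div_le_iff₀ hε] at h2
        rw [div_mul_eq_mul_div, le_div_iff₀ (by positivity)]
        linarith
      · rw [indicator_of_notMem hmem]
        simp
    refine hle.trans ?_
    rw [← ofReal_integral_eq_lintegral_ofReal ((hint k).const_mul _)
      ((hpos k).mono fun x hx => by have := hnn _ hx; positivity), integral_const_mul]
    refine ENNReal.ofReal_le_ofReal ?_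
    rw [div_mul_eq_mul_div, div_le_iff₀ (by positivity)]
    exact mul_le_mul_of_nonneg_left (by linarith [hbd k]) hε.le
  have hmem : MemLp δ 1 μ :=
    UniformIntegrable.memLp_of_ae_tendsto (u := atTop) hUI hlim
  exact ⟨memLp_one_iff_integrable.1 hmem,
    tendsto_Lp_finite_of_tendsto_ae le_rfl ENNReal.one_ne_top hm hmem hUI.unifIntegrable hlim⟩

end Compactness

/-! ### Joint convexity of the energy density -/

/-- Midpoint convexity of the perspective function `x ^ n / v ^ (n - 1)`. -/
lemma pow_div_pow_midpoint_le {n : ℕ} (hn : 1 ≤ n) {x y v w : ℝ} (hx : 0 ≤ x) (hy : 0 ≤ y)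
    (hv : 0 < v) (hw : 0 < w) :
    ((x + y) / 2) ^ n / ((v + w) / 2) ^ (n - 1) ≤
      (x ^ n / v ^ (n - 1) + y ^ n / w ^ (n - 1)) / 2 := by
  obtain ⟨m, rfl⟩ : ∃ m, n = m + 1 := ⟨n - 1, by omega⟩
  rw [Nat.add_sub_cancel]
  have hconv := (convexOn_pow (𝕜 := ℝ) (m + 1)).2
  -- Convexity of the power at the ratios `x / v`, `y / w` with weights proportional to `v`, `w`:
  -- the weighted mean is `(x + y) / (v + w)`.
  have key := hconv (x := x / v) (mem_Ici.2 (by positivity))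
    (y := y / w) (mem_Ici.2 (by positivity)) (a := v / (v + w)) (b := w / (v + w))
    (by positivity) (by positivity) (by field_simp)
  simp only [smul_eq_mul] at key
  have e1 : v / (v + w) * (x / v) + w / (v + w) * (y / w) = (x + y) / (v + w) := by field_simp
  rw [e1] at key
  have key' := mul_le_mul_of_nonneg_left key (show 0 ≤ (v + w) / 2 by positivity)
  have e2 : ((x + y) / 2) ^ (m + 1) / ((v + w) / 2) ^ m =
      (v + w) / 2 * ((x + y) / (v + w)) ^ (m + 1) := by
    rw [div_pow, div_pow, div_pow]
    field_simp
    ring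
  have e3 : (x ^ (m + 1) / v ^ m + y ^ (m + 1) / w ^ m) / 2 =
      (v + w) / 2 * (v / (v + w) * (x / v) ^ (m + 1) + w / (v + w) * (y / w) ^ (m + 1)) := by
    rw [div_pow, div_pow]
    field_simp
    ring
  rw [e2, e3]
  exact key'

/-- The perspective term is convex and the logarithmic term is linear in `d`, so the whole defect of
`h` remains as a surplus. -/
lemma convexDensity_midpoint_add_gap_le {n : ℕ} (hn : 1 ≤ n) {κ : ℝ} (hκ : 0 < κ) (h : ℝ → ℝ)
    {R w₁ w₂ d₁ d₂ : ℝ} (hR : 0 < R) (hw₁ : 0 < w₁) (hw₂ : 0 < w₂) (hd₁ : 0 ≤ d₁) (hd₂ : 0 ≤ d₂) :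
    convexDensity n κ h R ((w₁ + w₂) / 2) ((d₁ + d₂) / 2) + midpointGap h d₁ d₂ ≤
      (convexDensity n κ h R w₁ d₁ + convexDensity n κ h R w₂ d₂) / 2 := by
  have h1 := pow_div_pow_midpoint_le hn hd₁ hd₂ hw₁ hw₂
  have h2 := mul_le_mul_of_nonneg_left h1 (show 0 ≤ κ / n * R ^ (n * (n - 1)) by positivity)
  have e : ∀ x w : ℝ, κ / n * (x * R ^ (n * (n - 1)) / w) =
      κ / n * R ^ (n * (n - 1)) * (x / w) := fun x w => by ring
  unfold convexDensity midpointGap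
  rw [e, e, e]
  linarith

/-! ### The direct method for determinants -/

section Existence

variable {n : ℕ} {κ L : ℝ} {h δ δ₁ δ₂ : ℝ → ℝ}

lemma radiusPow_midpoint (h₁ : Integrable δ₁ (radialMeasure n))
    (h₂ : Integrable δ₂ (radialMeasure n)) (R : ℝ) :
    radiusPow n L (fun x => (δ₁ x + δ₂ x) / 2) R =
      (radiusPow n L δ₁ R + radiusPow n L δ₂ R) / 2 := by
  unfold radiusPow
  rw [integral_div, integral_add h₁.integrableOn h₂.integrableOn]
  ring

lemma midpoint_mem_admissibleDet (h₁ : δ₁ ∈ admissibleDet n L) (h₂ : δ₂ ∈ admissibleDet n L) :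
    (fun x => (δ₁ x + δ₂ x) / 2) ∈ admissibleDet n L := by
  refine ⟨(h₁.1.add h₂.1).div_const 2, ?_, ?_⟩
  · filter_upwards [h₁.2.1, h₂.2.1] with x h1 h2
    positivity
  · rw [integral_div, integral_add h₁.1 h₂.1]
    linarith [h₁.2.2, h₂.2.2]

/-- The density of the convex energy of `δ`. -/
noncomputable def detDensity (n : ℕ) (κ : ℝ) (h : ℝ → ℝ) (L : ℝ) (δ : ℝ → ℝ) (R : ℝ) : ℝ :=
  convexDensity n κ h R (radiusPow n L δ R) (δ R)

lemma ae_le_detDensity (hn : 1 ≤ n) (hκ : 0 < κ) (h_nonneg : ∀ d, 0 < d → 0 ≤ h d)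
    (hδ : δ ∈ admissibleDet n L) :
    ∀ᵐ R ∂(radialMeasure n), 0 ≤ h (δ R) ∧ h (δ R) ≤ detDensity n κ h L δ R := by
  filter_upwards [ae_mem_Ioo_radialMeasure n, hδ.2.1] with R hR hd
  refine ⟨h_nonneg _ hd, ?_⟩
  -- Taking `h := 0` isolates the other two terms, which are nonnegative.
  have := convexDensity_nonneg hn hκ (h := 0) (d := δ R) le_rfl hR
    (radiusPow_pos hn hδ R ⟨hR.1, hR.2.le⟩).le hd.le
  unfold detDensity
  unfold convexDensity at this ⊢
  simp only [Pi.zero_apply] at this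
  linarith

lemma ae_detDensity_nonneg (hn : 1 ≤ n) (hκ : 0 < κ) (h_nonneg : ∀ d, 0 < d → 0 ≤ h d)
    (hδ : δ ∈ admissibleDet n L) : 0 ≤ᵐ[radialMeasure n] detDensity n κ h L δ :=
  (ae_le_detDensity hn hκ h_nonneg hδ).mono fun _ hx => hx.1.trans hx.2

lemma convexEnergy_eq_ofReal (hn : 1 ≤ n) (hκ : 0 < κ) (h_nonneg : ∀ d, 0 < d → 0 ≤ h d)
    (hδ : δ ∈ admissibleDet n L) (hi : Integrable (detDensity n κ h L δ) (radialMeasure n)) :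
    convexEnergy n κ h L δ = ENNReal.ofReal (∫ R, detDensity n κ h L δ R ∂(radialMeasure n)) :=
  (ofReal_integral_eq_lintegral_ofReal hi (ae_detDensity_nonneg hn hκ h_nonneg hδ)).symm

lemma integrable_detDensity (hn : 1 ≤ n) (hκ : 0 < κ) (hh : ContinuousOn h (Ioi 0))
    (h_nonneg : ∀ d, 0 < d → 0 ≤ h d) (hδ : δ ∈ admissibleDet n L)
    (hfin : convexEnergy n κ h L δ ≠ ⊤) :
    Integrable (detDensity n κ h L δ) (radialMeasure n) := by
  refine ⟨(aemeasurable_convexDensity hh hδ).aestronglyMeasurable, ?_⟩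
  rw [hasFiniteIntegral_iff_ofReal (ae_detDensity_nonneg hn hκ h_nonneg hδ)]
  exact lt_top_iff_ne_top.2 hfin

/-- The total energy of a determinant of finite energy. -/
noncomputable def totalEnergy (n : ℕ) (κ : ℝ) (h : ℝ → ℝ) (L : ℝ) (δ : ℝ → ℝ) : ℝ :=
  ∫ R, detDensity n κ h L δ R ∂(radialMeasure n) + cavityEnergy n κ (radiusPow n L δ 0)

/-- The homogeneous deformation has finite energy. -/
lemma homogeneous_finite_energy (hn : 1 ≤ n) (hL : 0 < L) :
    (fun _ => L) ∈ admissibleDet n L ∧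
      Integrable (detDensity n κ h L fun _ => L) (radialMeasure n) := by
  have hn0 : (n : ℝ) ≠ 0 := by exact_mod_cast (by omega : n ≠ 0)
  have hcast : ((n - 1 : ℕ) : ℝ) + 1 = n := by
    rw [Nat.cast_sub hn]
    simp
  -- A constant determinant `L` corresponds to `r(R) = lam * R` when `L = lam ^ n`, with no cavity;
  -- only `log R` is unbounded in its density.
  have hw : ∀ x ∈ Icc (0 : ℝ) 1, radiusPow n L (fun _ => L) x = L * x ^ n := by
    intro x hx
    rw [radiusPow, setIntegral_radialMeasure _ _ hx, intervalIntegral.integral_mul_const,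
      integral_pow, hcast, Nat.sub_add_cancel hn]
    field_simp
    ring
  have h0 := hw 0 (by simp)
  rw [radiusPow_zero, zero_pow (by omega), mul_zero] at h0
  refine ⟨⟨integrable_const _, ae_of_all _ fun _ => hL, by linarith⟩, ?_⟩
  rw [integrable_radialMeasure_iff]
  have hlog : IntegrableOn Real.log (Ioo 0 1) :=
    (intervalIntegrable_iff_integrableOn_Ioo_of_le zero_le_one).1
      intervalIntegral.intervalIntegrable_log'
  have hmain : IntegrableOn (fun R : ℝ => (κ / n * L + h L - κ * ((n : ℝ) - 1) * L * Real.log R) *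
      R ^ (n - 1)) (Ioo 0 1) := by
    refine Integrable.mul_bdd (c := 1) ((integrable_const _).sub (hlog.const_mul _))
      (by fun_prop) ?_
    filter_upwards [ae_restrict_mem measurableSet_Ioo] with R hR
    rw [Real.norm_eq_abs, abs_of_nonneg (pow_nonneg hR.1.le _)]
    exact pow_le_one₀ hR.1.le hR.2.le
  refine hmain.congr ?_
  filter_upwards [ae_restrict_mem measurableSet_Ioo] with R hR
  have hR0 := hR.1
  rw [detDensity, convexDensity, hw R (Ioo_subset_Icc_self hR)]
  have : L ^ n * R ^ (n * (n - 1)) / (L * R ^ n) ^ (n - 1) = L := by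
    rw [mul_pow, ← pow_mul, mul_div_mul_right _ _ (pow_pos hR0 _).ne',
      div_eq_iff (pow_pos hL _).ne', ← pow_succ', Nat.sub_add_cancel hn]
  rw [this]
  ring

/-- The midpoint gap of two determinants of finite energy is bounded by the gap of the energies. -/
lemma integral_midpointGap_le (hn : 1 ≤ n) (hκ : 0 < κ) (hh : ContinuousOn h (Ioi 0))
    (hc : ConvexOn ℝ (Ioi 0) h) (h_nonneg : ∀ d, 0 < d → 0 ≤ h d)
    (hδ₁ : δ₁ ∈ admissibleDet n L) (hδ₂ : δ₂ ∈ admissibleDet n L)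
    (hi₁ : Integrable (detDensity n κ h L δ₁) (radialMeasure n))
    (hi₂ : Integrable (detDensity n κ h L δ₂) (radialMeasure n)) :
    Integrable (detDensity n κ h L fun x => (δ₁ x + δ₂ x) / 2) (radialMeasure n) ∧
    Integrable (fun R => midpointGap h (δ₁ R) (δ₂ R)) (radialMeasure n) ∧
    ∫ R, detDensity n κ h L (fun x => (δ₁ x + δ₂ x) / 2) R ∂(radialMeasure n) +
        ∫ R, midpointGap h (δ₁ R) (δ₂ R) ∂(radialMeasure n) ≤
      (∫ R, detDensity n κ h L δ₁ R ∂(radialMeasure n) +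
        ∫ R, detDensity n κ h L δ₂ R ∂(radialMeasure n)) / 2 := by
  have hmid := midpoint_mem_admissibleDet hδ₁ hδ₂
  have hle : ∀ᵐ R ∂(radialMeasure n), detDensity n κ h L (fun x => (δ₁ x + δ₂ x) / 2) R +
      midpointGap h (δ₁ R) (δ₂ R) ≤ (detDensity n κ h L δ₁ R + detDensity n κ h L δ₂ R) / 2 := by
    filter_upwards [ae_mem_Ioo_radialMeasure n, hδ₁.2.1, hδ₂.2.1] with R hR h1 h2
    unfold detDensity
    rw [radiusPow_midpoint hδ₁.1 hδ₂.1]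
    exact convexDensity_midpoint_add_gap_le hn hκ h hR.1
      (radiusPow_pos hn hδ₁ R ⟨hR.1, hR.2.le⟩) (radiusPow_pos hn hδ₂ R ⟨hR.1, hR.2.le⟩) h1.le h2.le
  have hgap0 : ∀ᵐ R ∂(radialMeasure n), 0 ≤ midpointGap h (δ₁ R) (δ₂ R) := by
    filter_upwards [hδ₁.2.1, hδ₂.2.1] with R h1 h2
    exact midpointGap_nonneg hc h1 h2
  have hmid0 := ae_detDensity_nonneg hn hκ h_nonneg hmid
  have havg : Integrable (fun R => (detDensity n κ h L δ₁ R + detDensity n κ h L δ₂ R) / 2)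
      (radialMeasure n) := (hi₁.add hi₂).div_const 2
  have hm : ∀ {δ}, δ ∈ admissibleDet n L → AEMeasurable (fun R => h (δ R)) (radialMeasure n) :=
    fun hδ => aemeasurable_comp_of_ae_pos hh hδ.1.aestronglyMeasurable.aemeasurable hδ.2.1
  have hgi : Integrable (fun R => midpointGap h (δ₁ R) (δ₂ R)) (radialMeasure n) := by
    refine havg.mono' ((((hm hδ₁).add (hm hδ₂)).div_const 2).sub (hm hmid)).aestronglyMeasurable ?_
    filter_upwards [hle, hgap0, hmid0] with R h1 h2 h3
    simp only [Pi.zero_apply] at h3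
    rw [Real.norm_eq_abs, abs_of_nonneg h2]
    linarith
  have hmi : Integrable (detDensity n κ h L fun x => (δ₁ x + δ₂ x) / 2) (radialMeasure n) := by
    refine havg.mono' (aemeasurable_convexDensity hh hmid).aestronglyMeasurable ?_
    filter_upwards [hle, hgap0, hmid0] with R h1 h2 h3
    simp only [Pi.zero_apply] at h3
    rw [Real.norm_eq_abs, abs_of_nonneg h3]
    linarith
  refine ⟨hmi, hgi, ?_⟩
  rw [← integral_add hmi hgi, ← integral_add hi₁ hi₂, ← integral_div]
  exact integral_mono_ae (hmi.add hgi) havg hle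

/-- Lower semicontinuity of the convex energy along sequences of determinants which converge
almost everywhere and in mean. -/
lemma convexEnergy_le_of_tendsto (hn : 1 ≤ n) (hκ : 0 < κ) (hh : ContinuousOn h (Ioi 0))
    (h_nonneg : ∀ d, 0 < d → 0 ≤ h d) {d : ℕ → ℝ → ℝ} (hd : ∀ k, d k ∈ admissibleDet n L)
    (hi : ∀ k, Integrable (detDensity n κ h L (d k)) (radialMeasure n))
    (hδ : δ ∈ admissibleDet n L)
    (hw : ∀ R, Tendsto (fun k => radiusPow n L (d k) R) atTop (𝓝 (radiusPow n L δ R)))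
    (hlim : ∀ᵐ R ∂(radialMeasure n), Tendsto (fun k => d k R) atTop (𝓝 (δ R))) {e : ℝ}
    (he : Tendsto (fun k => ∫ R, detDensity n κ h L (d k) R ∂(radialMeasure n)) atTop (𝓝 e)) :
    convexEnergy n κ h L δ ≤ ENNReal.ofReal e := by
  have hpt : ∀ᵐ R ∂(radialMeasure n), Tendsto (fun k => ENNReal.ofReal (detDensity n κ h L (d k) R))
      atTop (𝓝 (ENNReal.ofReal (detDensity n κ h L δ R))) := by
    filter_upwards [ae_mem_Ioo_radialMeasure n, hδ.2.1, hlim] with R hR hpos hl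
    have hwpos := radiusPow_pos hn hδ R ⟨hR.1, hR.2.le⟩
    refine (ENNReal.continuous_ofReal.tendsto _).comp ?_
    unfold detDensity convexDensity
    refine Tendsto.add (Tendsto.add (Tendsto.const_mul _ (Tendsto.div ?_ ((hw R).pow _) ?_)) ?_) ?_
    · exact (hl.pow n).mul_const _
    · positivity
    · exact ((hh.continuousAt (Ioi_mem_nhds hpos)).tendsto).comp hl
    · exact (hl.mul_const _).const_mul _
  calc convexEnergy n κ h L δ
      = ∫⁻ R, liminf (fun k => ENNReal.ofReal (detDensity n κ h L (d k) R)) atTop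
          ∂(radialMeasure n) := by
        refine lintegral_congr_ae ?_
        filter_upwards [hpt] with R hR
        exact hR.liminf_eq.symm
    _ ≤ liminf (fun k => ∫⁻ R, ENNReal.ofReal (detDensity n κ h L (d k) R) ∂(radialMeasure n))
          atTop := lintegral_liminf_le' fun k =>
        (aemeasurable_convexDensity hh (hd k)).ennreal_ofReal
    _ = ENNReal.ofReal e := by
        refine Tendsto.liminf_eq ?_
        have := (ENNReal.continuous_ofReal.tendsto e).comp he
        refine this.congr fun k => ?_
        exact ofReal_integral_eq_lintegral_ofReal (hi k)
          (ae_detDensity_nonneg hn hκ h_nonneg (hd k))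

/-- Existence of a minimizer of the total energy among admissible determinants. -/
lemma exists_minimizer_det (hn : 1 ≤ n) (hκ : 0 < κ) (hL : 0 < L) (hh : ContinuousOn h (Ioi 0))
    (hc : StrictConvexOn ℝ (Ioi 0) h) (h_nonneg : ∀ d, 0 < d → 0 ≤ h d)
    (h_zero : Tendsto h (𝓝[>] 0) atTop) (h_sup : Tendsto (fun d => h d / d) atTop atTop) :
    ∃ δ₀ ∈ admissibleDet n L, Integrable (detDensity n κ h L δ₀) (radialMeasure n) ∧
      ∀ δ ∈ admissibleDet n L, Integrable (detDensity n κ h L δ) (radialMeasure n) →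
        totalEnergy n κ h L δ₀ ≤ totalEnergy n κ h L δ := by
  have h_top : Tendsto h atTop atTop := by
    refine tendsto_atTop_mono' _ ?_ tendsto_id
    filter_upwards [h_sup.eventually_ge_atTop 1, eventually_gt_atTop 0] with x h1 h2
    rwa [le_div_iff₀ h2, one_mul] at h1
  obtain ⟨M, hM⟩ := (isCompact_Icc (a := (0 : ℝ)) (b := L)).exists_bound_of_continuousOn
    (continuous_cavityEnergy n κ).continuousOn
  have hcav : ∀ δ ∈ admissibleDet n L, |cavityEnergy n κ (radiusPow n L δ 0)| ≤ M := fun δ hδ =>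
    hM _ ⟨radiusPow_zero_nonneg hδ, radiusPow_zero_le hδ⟩
  have hint0 : ∀ δ ∈ admissibleDet n L, 0 ≤ ∫ R, detDensity n κ h L δ R ∂(radialMeasure n) :=
    fun δ hδ => integral_nonneg_of_ae (ae_detDensity_nonneg hn hκ h_nonneg hδ)
  set T : Set ℝ := totalEnergy n κ h L ''
    {δ | δ ∈ admissibleDet n L ∧ Integrable (detDensity n κ h L δ) (radialMeasure n)} with hT
  have hTne : T.Nonempty := ⟨_, mem_image_of_mem _ (homogeneous_finite_energy hn hL)⟩
  have hTbdd : BddBelow T := by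
    refine ⟨-M, ?_⟩
    rintro _ ⟨δ, ⟨hδ, -⟩, rfl⟩
    have := (abs_le.1 (hcav δ hδ)).1
    have := hint0 δ hδ
    unfold totalEnergy
    linarith
  set m := sInf T with hm
  have hmle : ∀ δ ∈ admissibleDet n L, Integrable (detDensity n κ h L δ) (radialMeasure n) →
      m ≤ totalEnergy n κ h L δ := fun δ hδ hi => csInf_le hTbdd ⟨δ, ⟨hδ, hi⟩, rfl⟩
  obtain ⟨u, -, hu, huT⟩ := exists_seq_tendsto_sInf hTne hTbdd
  choose d₀ hd₀ hud₀ using huT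
  -- Fixing the limit of `w(0)` first makes the nonconvex cavity term converge, and hence the convex
  -- energies as well.
  obtain ⟨c, hcI, τ, hτ, hcτ⟩ := (isCompact_Icc (a := (0 : ℝ)) (b := L)).tendsto_subseq
    (x := fun k => radiusPow n L (d₀ k) 0)
    (fun k => ⟨radiusPow_zero_nonneg (hd₀ k).1, radiusPow_zero_le (hd₀ k).1⟩)
  set d : ℕ → ℝ → ℝ := fun k => d₀ (τ k) with hd
  have hdB : ∀ k, d k ∈ admissibleDet n L := fun k => (hd₀ (τ k)).1
  have hdi : ∀ k, Integrable (detDensity n κ h L (d k)) (radialMeasure n) :=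
    fun k => (hd₀ (τ k)).2
  have hV : Tendsto (fun k => totalEnergy n κ h L (d k)) atTop (𝓝 m) :=
    (hu.comp hτ.tendsto_atTop).congr fun k => (hud₀ (τ k)).symm
  have hcc : Tendsto (fun k => radiusPow n L (d k) 0) atTop (𝓝 c) := hcτ
  have hcav_lim : Tendsto (fun k => cavityEnergy n κ (radiusPow n L (d k) 0)) atTop
      (𝓝 (cavityEnergy n κ c)) := ((continuous_cavityEnergy n κ).tendsto c).comp hcc
  have hE : Tendsto (fun k => ∫ R, detDensity n κ h L (d k) R ∂(radialMeasure n)) atTop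
      (𝓝 (m - cavityEnergy n κ c)) := by
    refine (hV.sub hcav_lim).congr fun k => ?_
    unfold totalEnergy
    ring
  obtain ⟨C₀, hC₀⟩ := hE.bddAbove_range
  have hC₀' : ∀ k, ∫ R, detDensity n κ h L (d k) R ∂(radialMeasure n) ≤ C₀ :=
    fun k => hC₀ ⟨k, rfl⟩
  have hdm : ∀ k, AEMeasurable (d k) (radialMeasure n) := fun k =>
    (hdB k).1.aestronglyMeasurable.aemeasurable
  have hhi : ∀ k, Integrable (fun R => h (d k R)) (radialMeasure n) := fun k => by
    refine (hdi k).mono' (aemeasurable_comp_of_ae_pos hh (hdm k)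
      (hdB k).2.1).aestronglyMeasurable ?_
    filter_upwards [ae_le_detDensity hn hκ h_nonneg (hdB k)] with R hR
    rw [Real.norm_eq_abs, abs_of_nonneg hR.1]
    exact hR.2
  have hhb : ∀ k, ∫ R, h (d k R) ∂(radialMeasure n) ≤ C₀ := fun k =>
    (integral_mono_ae (hhi k) (hdi k) ((ae_le_detDensity hn hκ h_nonneg (hdB k)).mono
      fun R hR => hR.2)).trans (hC₀' k)
  have hgap : ∀ ε > 0, ∃ N, ∀ k ≥ N, ∀ l ≥ N,
      ∫ R, midpointGap h (d k R) (d l R) ∂(radialMeasure n) ≤ ε := by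
    intro ε hε
    -- This expression bounds the integrated gap from above, because the midpoint has total energy
    -- at least `m`. Its limit is zero by continuity of the cavity term alone.
    have hlim : Tendsto (fun z : ℕ × ℕ =>
        (∫ R, detDensity n κ h L (d z.1) R ∂(radialMeasure n) +
          ∫ R, detDensity n κ h L (d z.2) R ∂(radialMeasure n)) / 2 - m +
          cavityEnergy n κ ((radiusPow n L (d z.1) 0 + radiusPow n L (d z.2) 0) / 2))
        (atTop ×ˢ atTop) (𝓝 ((m - cavityEnergy n κ c + (m - cavityEnergy n κ c)) / 2 - m +
          cavityEnergy n κ ((c + c) / 2))) := by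
      refine Tendsto.add (Tendsto.sub_const (Tendsto.div_const (Tendsto.add ?_ ?_) 2) m)
        (((continuous_cavityEnergy n κ).tendsto _).comp
          (Tendsto.div_const (Tendsto.add ?_ ?_) 2))
      · exact hE.comp tendsto_fst
      · exact hE.comp tendsto_snd
      · exact hcc.comp tendsto_fst
      · exact hcc.comp tendsto_snd
    rw [show (m - cavityEnergy n κ c + (m - cavityEnergy n κ c)) / 2 - m +
      cavityEnergy n κ ((c + c) / 2) = 0 by rw [add_self_div_two, add_self_div_two]; ring,
      prod_atTop_atTop_eq] at hlim
    obtain ⟨⟨N₁, N₂⟩, hN⟩ := eventually_atTop.1 (hlim.eventually_le_const hε)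
    refine ⟨max N₁ N₂, fun k hk l hl => ?_⟩
    have h1 := hN (k, l) ⟨(le_max_left _ _).trans hk, (le_max_right _ _).trans hl⟩
    obtain ⟨i1, -, i3⟩ := integral_midpointGap_le hn hκ hh hc.convexOn h_nonneg (hdB k) (hdB l)
      (hdi k) (hdi l)
    have h2 := hmle _ (midpoint_mem_admissibleDet (hdB k) (hdB l)) i1
    unfold totalEnergy at h2
    rw [radiusPow_midpoint (hdB k).1 (hdB l).1] at h2
    simp only at h1
    linarith
  obtain ⟨σ, hσ, δ, hδ⟩ := exists_subseq_ae_tendsto hc hh h_nonneg h_zero h_top hdm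
    (fun k => (hdB k).2.1) hhi hhb
    (fun k l => (integral_midpointGap_le hn hκ hh hc.convexOn h_nonneg (hdB k) (hdB l)
      (hdi k) (hdi l)).2.1) hgap
  have hlim : ∀ᵐ R ∂(radialMeasure n), Tendsto (fun k => d (σ k) R) atTop (𝓝 (δ R)) :=
    hδ.mono fun R hR => hR.2
  obtain ⟨hδi, hL1⟩ := tendsto_eLpNorm_of_superlinear (d := fun k => d (σ k)) h_nonneg h_sup
    (fun k => (hdm (σ k)).aestronglyMeasurable) (fun k => (hdB (σ k)).2.1) (fun k => hhi (σ k))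
    (fun k => hhb (σ k)) hlim
  have hwlim : ∀ R, Tendsto (fun k => radiusPow n L (d (σ k)) R) atTop
      (𝓝 (radiusPow n L δ R)) := fun R => by
    have := tendsto_setIntegral_of_L1' δ hδi.aestronglyMeasurable
      (Eventually.of_forall fun k => (hdB (σ k)).1) hL1 (Ioo R 1)
    exact (this.const_mul (n : ℝ)).const_sub L
  have hδB : δ ∈ admissibleDet n L := by
    refine ⟨hδi, hδ.mono fun R hR => hR.1, ?_⟩
    have : 0 ≤ radiusPow n L δ 0 :=
      ge_of_tendsto' (hwlim 0) fun k => radiusPow_zero_nonneg (hdB (σ k))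
    rw [radiusPow_zero] at this
    linarith
  have hle := convexEnergy_le_of_tendsto hn hκ hh h_nonneg (fun k => hdB (σ k))
    (fun k => hdi (σ k)) hδB hwlim hlim (hE.comp hσ.tendsto_atTop)
  have hδfin := integrable_detDensity hn hκ hh h_nonneg hδB (hle.trans_lt ENNReal.ofReal_lt_top).ne
  refine ⟨δ, hδB, hδfin, fun δ' hδ' hi' => le_trans ?_ (hmle δ' hδ' hi')⟩
  rw [convexEnergy_eq_ofReal hn hκ h_nonneg hδB hδfin, ENNReal.ofReal_le_ofReal_iff
    (ge_of_tendsto' hE fun k => hint0 _ (hdB k))] at hle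
  -- Convergence in mean lets no mass concentrate at the origin, so the limit has cavity parameter
  -- `c` and its total energy is at most `m`.
  have hc0 : radiusPow n L δ 0 = c :=
    tendsto_nhds_unique (hwlim 0) (hcc.comp hσ.tendsto_atTop)
  unfold totalEnergy
  rw [hc0]
  linarith

end Existence

end RadialCavitation

/-! ### Transfer of the minimizer to deformations -/

open RadialCavitation in
theorem mainTheorem1 (n : ℕ) (hn : 2 ≤ n) (κ : ℝ) (hκ : 0 < κ) (lam : ℝ) (hlam : 0 < lam)
    (h : ℝ → ℝ) (h_nonneg : ∀ d : ℝ, 0 < d → 0 ≤ h d) (h_convex : ConvexOn ℝ (Set.Ioi 0) h)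
    (h_cond : RadialCavitation.StructuralConditions h) :
    ∃ r₀ ∈ RadialCavitation.admissible lam,
      IsMinOn (RadialCavitation.modifiedEnergy n κ h lam) (RadialCavitation.admissible lam) r₀ ∧
      RadialCavitation.modifiedEnergy n κ h lam r₀ ≠ ⊥ ∧
      RadialCavitation.modifiedEnergy n κ h lam r₀ ≠ ⊤ := by
  have hn1 : 1 ≤ n := by omega
  have hh : ContinuousOn h (Ioi 0) := h_cond.contDiffOn.continuousOn
  have hc : StrictConvexOn ℝ (Ioi 0) h :=
    strictConvexOn_of_deriv2_pos' (convex_Ioi 0) hh fun d hd => h_cond.second_deriv_pos d hd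
  obtain ⟨δ₀, hδ₀, hi₀, hmin⟩ := exists_minimizer_det hn1 hκ (pow_pos hlam n) hh hc h_nonneg
    h_cond.tendsto_zero h_cond.superlinear
  obtain ⟨r₀, hr₀, hdet⟩ := exists_admissible_det_eq hn1 hlam hδ₀
  have hfinite : ∀ δ ∈ admissibleDet n (lam ^ n),
      Integrable (detDensity n κ h (lam ^ n) δ) (radialMeasure n) →
      ((convexEnergy n κ h (lam ^ n) δ : ENNReal) : EReal) +
        ((cavityEnergy n κ (radiusPow n (lam ^ n) δ 0) : ℝ) : EReal) =
      ((totalEnergy n κ h (lam ^ n) δ : ℝ) : EReal) := fun δ hδ hi => by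
    rw [convexEnergy_eq_ofReal hn1 hκ h_nonneg hδ hi, EReal.coe_ennreal_ofReal,
      max_eq_left (integral_nonneg_of_ae (ae_detDensity_nonneg hn1 hκ h_nonneg hδ)),
      totalEnergy, EReal.coe_add]
  have hE₀ : modifiedEnergy n κ h lam r₀ = ((totalEnergy n κ h (lam ^ n) δ₀ : ℝ) : EReal) := by
    rw [modifiedEnergy_eq hn1 hκ hh h_nonneg hr₀, convexEnergy_congr hdet, radiusPow_congr hdet,
      hfinite δ₀ hδ₀ hi₀]
  refine ⟨r₀, hr₀, fun r hr => ?_, ?_, ?_⟩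
  · have hδ := det_mem_admissibleDet hn1 hr
    rw [mem_ofPred_eq, hE₀, modifiedEnergy_eq hn1 hκ hh h_nonneg hr]
    by_cases hfin : convexEnergy n κ h (lam ^ n) (det n r) = ⊤
    · rw [hfin, EReal.coe_ennreal_top, EReal.top_add_coe]
      exact le_top
    · have hi := integrable_detDensity hn1 hκ hh h_nonneg hδ hfin
      rw [hfinite _ hδ hi]
      exact EReal.coe_le_coe_iff.2 (hmin _ hδ hi)
  · rw [hE₀]
    exact EReal.coe_ne_bot _
  · rw [hE₀]
    exact EReal.coe_ne_top _
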